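/- Let $\mathcal A^1,\mathcal A^2$ be finite non-empty action sets, $A_{\max}=\max(|\mathcal A^1|,|\mathcal A^2|)$, and let $\mathcal R^1\in\mathbb R^{|\mathcal A^1|\times|\mathcal A^2|}$, $\mathcal R^2=-(\mathcal R^1)^\top$ be the payoff matrices of a two-player zero-sum game with $\max_{a^1,a^2}|\mathcal R^1(a^1,a^2)|\le 1$. For policies $\pi^i\in\Delta^{|\mathcal A^i|}$ (probability vectors) the Nash gap is $$\mathrm{NG}(\pi^1,\pi^2)=\sum_{i=1,2}\max_{\hat\pi^i\in\Delta^{|\mathcal A^i|}}(\hat\pi^i-\pi^i)^\top\mathcal R^i\pi^{-i},$$ where $-i$ denotes the opponent of player $i$. Let $\tau>0$, let $[\sigma_\tau(q)](a)=e^{q(a)/\tau}/\sum_{a'}e^{q(a')/\tau}$, and let $$\ell_\tau=\bigl[1+(A_{\max}-1)\exp(2/\tau)\bigr]^{-1}.$$ Given stepsizes $\alpha_k$ and $\beta_k=c_{\alpha,\beta}\alpha_k$ with $c_{\alpha,\beta}\in(0,1)$, both players follow the doubly smoothed best-response (DSBR) dynamics: $\pi_0^i$ is the uniform policy and $q_0^i=0$;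 for $k=0,1,\dots,K-1$, player $i$ sets $\pi_{k+1}^i=\pi_k^i+\beta_k(\sigma_\tau(q_k^i)-\pi_k^i)$; then, conditionally on all earlier actions, the actions $A_k^1\sim\pi_{k+1}^1$ and $A_k^2\sim\pi_{k+1}^2$ are drawn independently; and finally $$q_{k+1}^i(a^i)=q_k^i(a^i)+\alpha_k\mathbf 1_{\{a^i=A_k^i\}}\bigl(\mathcal R^i(A_k^i,A_k^{-i})-q_k^i(A_k^i)\bigr)\quad\text{for all }a^i\in\mathcal A^i .$$ Theorem. There are numerical constants $c_0,c_1,c_2,c_3>0$ (independent of the game, of $\tau$, of the stepsizes and of $K$) such that the following holds for every $K\ge 0$ whenever $c_{\alpha,\beta}\le \dfrac{\ell_\tau^3\tau^3}{c_0A_{\max}^2}$. (1) If $\alpha_k\equiv\alpha>0$ with $c_{\alpha,\beta}\alpha\le 1$, then $$\mathbb E[\mathrm{NG}(\pi_K^1,\pi_K^2)]\le 3\Bigl(1-\frac{c_{\alpha,\beta}\alpha}{2}\Bigr)^K+\frac{c_1A_{\max}^{3/2}}{c_{\alpha,\beta}}\,\alpha+2\tau\log A_{\max}.$$ (2) If $\alpha_k=\alpha/(k+h)$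 with $\alpha>2/c_{\alpha,\beta}$ and $h>\alpha$, then $$\mathbb E[\mathrm{NG}(\pi_K^1,\pi_K^2)]\le 3\Bigl(\frac{h}{K+h}\Bigr)^{c_{\alpha,\beta}\alpha/2}+\frac{c_2A_{\max}^{3/2}\alpha}{c_{\alpha,\beta}\alpha-2}\,\frac{\alpha}{K+h}+2\tau\log A_{\max}.$$ (3) If $\alpha_k=\alpha/(k+h)^z$ with $\alpha>0$, $z\in(0,1)$, $h\ge\bigl(\frac{4z}{c_{\alpha,\beta}\alpha}\bigr)^{1/(1-z)}$ and $\alpha\le h^z$ (that is, $\alpha_0\le 1$), then $$\mathbb E[\mathrm{NG}(\pi_K^1,\pi_K^2)]\le 3\exp\Bigl(-\frac{c_{\alpha,\beta}\,\alpha\,\bigl((K+h)^{1-z}-h^{1-z}\bigr)}{2(1-z)}\Bigr)+\frac{c_3A_{\max}^{3/2}}{c_{\alpha,\beta}}\,\frac{\alpha}{(K+h)^z}+2\tau\log A_{\max}.$$ -/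

import Mathlib

universe u v w

namespace DSBR

open MeasureTheory Matrix

noncomputable section

/-- The softmax function with temperature `τ`. -/
def softmax {A : Type*} [Fintype A] (τ : ℝ) (q : A → ℝ) : A → ℝ :=
  fun a => Real.exp (q a / τ) / ∑ a', Real.exp (q a' / τ)

/-- `max_{p ∈ Δ(A)} (p - π)ᵀ R π'`: the largest gain a player with payoff matrix `R` can obtain by
deviating from `π` when the opponent plays `π'`. The supremum is a maximum, since the simplex is
compact (and non-empty when `A` is). -/
def deviationGain {A B : Type*} [Fintype A] [Fintype B] (R : Matrix A B ℝ)
    (π : A → ℝ) (π' : B → ℝ) : ℝ :=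
  sSup ((fun p : A → ℝ => (p - π) ⬝ᵥ (R *ᵥ π')) '' stdSimplex ℝ A)

/-- The Nash gap of the joint policy `(π₁, π₂)` in the zero-sum matrix game in which player 1 has
payoff matrix `R` and player 2 has payoff matrix `-Rᵀ`. -/
def nashGap {A₁ A₂ : Type*} [Fintype A₁] [Fintype A₂] (R : Matrix A₁ A₂ ℝ)
    (π₁ : A₁ → ℝ) (π₂ : A₂ → ℝ) : ℝ :=
  deviationGain R π₁ π₂ + deviationGain (-Rᵀ) π₂ π₁

/-- The larger of the two numbers of actions. -/
def maxActions (A₁ A₂ : Type*) [Fintype A₁] [Fintype A₂] : ℕ :=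
  max (Fintype.card A₁) (Fintype.card A₂)

/-- `ℓ_τ = 1 / (1 + (Amax - 1) exp (2 / τ))`. -/
def ell (τ Amax : ℝ) : ℝ := (1 + (Amax - 1) * Real.exp (2 / τ))⁻¹

/-- The pair of iterates `(π_k, q_k)` maintained by one player with action set `A`. -/
structure PlayerState (A : Type*) where
  policy : A → ℝ
  q : A → ℝ

/-- Initialization: the uniform policy and the zero `q`-function. -/
def PlayerState.init (A : Type*) [Fintype A] : PlayerState A where
  policy := fun _ => 1 / (Fintype.card A : ℝ)
  q := fun _ => 0

/-- One iteration of the learning dynamics of one player, with stepsizes `α` (for `q`) and `β` (for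
the policy), when the player plays the action `a` and receives the reward `r`. -/
def PlayerState.step {A : Type*} [Fintype A] [DecidableEq A] (τ α β : ℝ) (s : PlayerState A)
    (a : A) (r : ℝ) : PlayerState A where
  policy := fun a' => s.policy a' + β * (softmax τ s.q a' - s.policy a')
  q := fun a' => s.q a' + α * (if a' = a then r - s.q a else 0)

/-- The iterates of both players when the joint action in round `k` is `x k`, for `k = 0, 1, …`.
The iterates with index `k` only depend on `x 0, …, x (k - 1)`, and the policies with index `k + 1`
still only depend on `x 0, …, x (k - 1)`. -/
def iterates {A₁ A₂ : Type*} [Fintype A₁] [Fintype A₂] [DecidableEq A₁] [DecidableEq A₂]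
    (R : Matrix A₁ A₂ ℝ) (τ : ℝ) (α β : ℕ → ℝ) (x : ℕ → A₁ × A₂) :
    ℕ → PlayerState A₁ × PlayerState A₂
  | 0 => (PlayerState.init A₁, PlayerState.init A₂)
  | k + 1 =>
    let s := iterates R τ α β x k
    (s.1.step τ (α k) (β k) (x k).1 (R (x k).1 (x k).2),
      s.2.step τ (α k) (β k) (x k).2 ((-Rᵀ) (x k).2 (x k).1))

/-- `X k` is the joint action played in round `k` by two players who both follow the doubly smoothed
best-response dynamics for `K` rounds: conditionally on the joint actions of the rounds before `k`,
the two actions of round `k` are sampled independently from the current policies `π_{k+1}`. -/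
structure IsPlay {A₁ : Type u} {A₂ : Type v} [Fintype A₁] [Fintype A₂] [DecidableEq A₁]
    [DecidableEq A₂] {Ω : Type w} [MeasurableSpace Ω] (P : Measure Ω)
    (R : Matrix A₁ A₂ ℝ) (τ : ℝ) (α β : ℕ → ℝ) (K : ℕ) (X : ℕ → Ω → A₁ × A₂) : Prop where
  measurable : ∀ k < K, ∀ a, MeasurableSet {ω | X k ω = a}
  sampling : ∀ k < K, ∀ x : ℕ → A₁ × A₂,
    P.real {ω | ∀ j ≤ k, X j ω = x j} =
      P.real {ω | ∀ j < k, X j ω = x j} *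
        ((iterates R τ α β x (k + 1)).1.policy (x k).1 *
          (iterates R τ α β x (k + 1)).2.policy (x k).2)

/-- The Nash gap of the (random) output policies `(π_K¹, π_K²)` after `K` rounds. -/
def outputGap {A₁ : Type u} {A₂ : Type v} [Fintype A₁] [Fintype A₂] [DecidableEq A₁]
    [DecidableEq A₂] {Ω : Type w} (R : Matrix A₁ A₂ ℝ) (τ : ℝ) (α β : ℕ → ℝ) (K : ℕ)
    (X : ℕ → Ω → A₁ × A₂) : Ω → ℝ :=
  fun ω =>
    let s := iterates R τ α β (fun k => X k ω) K
    nashGap R s.1.policy s.2.policy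

end

end DSBR

/-!
The proof is a Lyapunov argument. The regularized Nash gap `regGap` replaces the two best-response
values in the Nash gap by their smooth versions `lse τ`, and adds the negative entropies
`τ * negEntropy`. The Nash gap exceeds it by at most the bias `2 τ log Amax`
(`nashGap_le_regGap_add`), and `regGap` is at most `2` at the uniform policies.

A policy step towards `softmax τ q` contracts `regGap` (`regGap_step_le`): `negEntropy` is convex,
`lse τ` is smooth with gradient the softmax (`lse_add_le`), and if `q` were the exact payoff
vector, then the cross terms of first order in the stepsize would cancel, because the game is
zero-sum, and leave the factor `1 - c α`.
The error due to the estimate `q` is bounded by a fraction of `regGap` plus a multiple of the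
squared estimation errors `qError`. This rests on a form of Pinsker's inequality
(`pinsker_softmax`) and on the Lipschitz continuity of the softmax, both of which follow from the
duality between `lse τ` and `negEntropy`.

Every action is played with probability at least `ℓ_τ`, so the expected `qError` contracts by a
factor `1 - α ℓ_τ / 2`, up to the sampling noise `4 α ^ 2` and up to the movement of the
opponent's policy, which is of order `c α` per round (`sum_qError_step_le`). As `c` is small, the weighted
sum `lyapunov` of both quantities contracts by a factor `1 - c α / 2`, up to `5 α ^ 2`
(`sum_lyapunov_step_le`).

The sampling rule of `IsPlay` turns this into a scalar recursion for the expectation of `lyapunov`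
over histories (`IsPlay.historyExpectation_lyapunov_succ_le`), and the three bounds are
supersolutions of this recursion for the three choices of stepsizes. Two regimes are trivial,
since the Nash gap is at most `2`, and at most `0` if both players have a single action: stepsizes
`α > 1` in the constant case, and `τ > 3 / 2`.
-/

namespace DSBR

open MeasureTheory Matrix

/-! ### Log-sum-exp, entropy and softmax -/

section Softmax

variable {A : Type*} [Fintype A]

/-- The scaled log-sum-exp function `τ log ∑ₐ exp (q a / τ)`, a smooth upper bound of `max q`. -/
noncomputable def lse (τ : ℝ) (q : A → ℝ) : ℝ := τ * Real.log (∑ a, Real.exp (q a / τ))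

/-- The negative Shannon entropy `∑ₐ p a log (p a)`. -/
noncomputable def negEntropy (p : A → ℝ) : ℝ := ∑ a, p a * Real.log (p a)

theorem abs_dotProduct_le {x y : A → ℝ} {s : ℝ} (hy : ∀ a, |y a| ≤ s) :
    |x ⬝ᵥ y| ≤ (∑ a, |x a|) * s := by
  rw [dotProduct, Finset.sum_mul]
  refine (Finset.abs_sum_le_sum_abs _ _).trans (Finset.sum_le_sum fun a _ => ?_)
  rw [abs_mul]
  exact mul_le_mul_of_nonneg_left (hy a) (abs_nonneg _)

theorem sum_abs_of_mem_stdSimplex {p : A → ℝ} (hp : p ∈ stdSimplex ℝ A) : ∑ a, |p a| = 1 := by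
  rw [← hp.2]
  exact Finset.sum_congr rfl fun a _ => abs_of_nonneg (hp.1 a)

theorem sum_abs_sub_le_two {p p' : A → ℝ} (hp : p ∈ stdSimplex ℝ A) (hp' : p' ∈ stdSimplex ℝ A) :
    ∑ a, |p a - p' a| ≤ 2 := by
  calc ∑ a, |p a - p' a| ≤ ∑ a, (|p a| + |p' a|) := Finset.sum_le_sum fun a _ => abs_sub _ _
    _ = 2 := by
      rw [Finset.sum_add_distrib, sum_abs_of_mem_stdSimplex hp, sum_abs_of_mem_stdSimplex hp']
      norm_num

theorem dotProduct_le_of_mem_stdSimplex {p y : A → ℝ} (hp : p ∈ stdSimplex ℝ A) {M : ℝ}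
    (hy : ∀ a, y a ≤ M) : p ⬝ᵥ y ≤ M := by
  calc p ⬝ᵥ y ≤ ∑ a, p a * M :=
        Finset.sum_le_sum fun a _ => mul_le_mul_of_nonneg_left (hy a) (hp.1 a)
    _ = M := by rw [← Finset.sum_mul, hp.2, one_mul]

theorem neg_log_card_le_negEntropy {p : A → ℝ} (hp : p ∈ stdSimplex ℝ A) [Nonempty A] :
    -Real.log (Fintype.card A) ≤ negEntropy p := by
  have hn : (0 : ℝ) < Fintype.card A := by exact_mod_cast Fintype.card_pos
  have key : ∀ a, p a - 1 / Fintype.card A ≤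
      p a * Real.log (p a) + p a * Real.log (Fintype.card A) := by
    intro a
    rcases (hp.1 a).eq_or_lt with h | h
    · rw [← h]; simp
    · have h1 := Real.one_sub_inv_le_log_of_pos (mul_pos h hn)
      rw [Real.log_mul h.ne' hn.ne'] at h1
      have h2 := mul_le_mul_of_nonneg_left h1 h.le
      have h3 : p a * (1 - (p a * Fintype.card A)⁻¹) = p a - 1 / Fintype.card A := by
        field_simp
      linarith
  have h := Finset.sum_le_sum fun a (_ : a ∈ Finset.univ) => key a
  rw [Finset.sum_sub_distrib, Finset.sum_add_distrib, ← Finset.sum_mul, hp.2] at h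
  simp only [Finset.sum_const, Finset.card_univ, nsmul_eq_mul] at h
  rw [mul_one_div_cancel hn.ne'] at h
  unfold negEntropy
  linarith

theorem negEntropy_uniform : negEntropy (fun _ : A => 1 / (Fintype.card A : ℝ)) =
    -Real.log (Fintype.card A) := by
  rcases isEmpty_or_nonempty A with h | h
  · simp [negEntropy]
  · have hn : (Fintype.card A : ℝ) ≠ 0 := by exact_mod_cast Fintype.card_ne_zero
    simp only [negEntropy, Finset.sum_const, Finset.card_univ, nsmul_eq_mul, one_div, Real.log_inv]
    field_simp

theorem negEntropy_convex_comb {p p' : A → ℝ} (hp : p ∈ stdSimplex ℝ A)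
    (hp' : p' ∈ stdSimplex ℝ A) {β : ℝ} (h0 : 0 ≤ β) (h1 : β ≤ 1) :
    negEntropy (fun a => p a + β * (p' a - p a)) ≤
      (1 - β) * negEntropy p + β * negEntropy p' := by
  unfold negEntropy
  rw [Finset.mul_sum, Finset.mul_sum, ← Finset.sum_add_distrib]
  refine Finset.sum_le_sum fun a _ => ?_
  have := Real.convexOn_mul_log.2 (hp.1 a) (hp'.1 a) (sub_nonneg.2 h1) h0 (by ring)
  simp only [smul_eq_mul] at this
  have e : p a + β * (p' a - p a) = (1 - β) * p a + β * p' a := by ring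
  simpa only [e] using this

variable [Nonempty A] {τ : ℝ}

theorem sum_exp_pos (τ : ℝ) (q : A → ℝ) : 0 < ∑ a, Real.exp (q a / τ) :=
  Finset.sum_pos (fun _ _ => Real.exp_pos _) Finset.univ_nonempty

theorem softmax_pos (τ : ℝ) (q : A → ℝ) (a : A) : 0 < softmax τ q a :=
  div_pos (Real.exp_pos _) (sum_exp_pos τ q)

theorem softmax_mem_stdSimplex (τ : ℝ) (q : A → ℝ) : softmax τ q ∈ stdSimplex ℝ A := by
  refine ⟨fun a => (softmax_pos τ q a).le, ?_⟩
  unfold softmax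
  rw [← Finset.sum_div, div_self (sum_exp_pos τ q).ne']

theorem mul_log_softmax (hτ : 0 < τ) (q : A → ℝ) (a : A) :
    τ * Real.log (softmax τ q a) = q a - lse τ q := by
  unfold softmax lse
  rw [Real.log_div (Real.exp_pos _).ne' (sum_exp_pos τ q).ne', Real.log_exp, mul_sub]
  congr 1
  field_simp

theorem le_lse (hτ : 0 < τ) (q : A → ℝ) (a : A) : q a ≤ lse τ q := by
  have h := mul_log_softmax hτ q a
  have h1 : softmax τ q a ≤ 1 := by
    rw [← (softmax_mem_stdSimplex τ q).2]
    exact Finset.single_le_sum (fun b _ => (softmax_pos τ q b).le) (Finset.mem_univ a)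
  have h2 := Real.log_nonpos (softmax_pos τ q a).le h1
  nlinarith

theorem lse_le (hτ : 0 < τ) {q : A → ℝ} {M : ℝ} (hq : ∀ a, q a ≤ M) :
    lse τ q ≤ M + τ * Real.log (Fintype.card A) := by
  have hn : (0 : ℝ) < Fintype.card A := by exact_mod_cast Fintype.card_pos
  have h : ∑ a, Real.exp (q a / τ) ≤ Fintype.card A * Real.exp (M / τ) := by
    calc ∑ a, Real.exp (q a / τ) ≤ ∑ _a : A, Real.exp (M / τ) :=
          Finset.sum_le_sum fun a _ => Real.exp_le_exp.2 (by gcongr; exact hq a)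
      _ = _ := by simp
  have h2 := Real.log_le_log (sum_exp_pos τ q) h
  rw [Real.log_mul hn.ne' (Real.exp_pos _).ne', Real.log_exp] at h2
  have h3 := mul_le_mul_of_nonneg_left h2 hτ.le
  have h4 : τ * (Real.log (Fintype.card A) + M / τ) = M + τ * Real.log (Fintype.card A) := by
    field_simp; ring
  unfold lse
  linarith

/-- The Gibbs variational inequality: `lse τ` is the convex conjugate of `τ • negEntropy`. -/
theorem dotProduct_sub_negEntropy_le_lse (hτ : 0 < τ) {p : A → ℝ} (hp : p ∈ stdSimplex ℝ A)
    (q : A → ℝ) : p ⬝ᵥ q - τ * negEntropy p ≤ lse τ q := by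
  have key : ∀ a, p a * q a - τ * (p a * Real.log (p a)) - p a * lse τ q ≤
      τ * (softmax τ q a - p a) := by
    intro a
    have hs := softmax_pos τ q a
    rcases (hp.1 a).eq_or_lt with h | h
    · rw [← h]; simp; positivity
    · have h1 := Real.log_le_sub_one_of_pos (div_pos hs h)
      rw [Real.log_div hs.ne' h.ne'] at h1
      have h2 := mul_le_mul_of_nonneg_left h1 (mul_pos hτ h).le
      have h3 : τ * p a * (softmax τ q a / p a - 1) = τ * (softmax τ q a - p a) := by
        field_simp
      have h4 := mul_log_softmax hτ q a
      have h5 : τ * p a * (Real.log (softmax τ q a) - Real.log (p a)) =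
          p a * (τ * Real.log (softmax τ q a)) - τ * (p a * Real.log (p a)) := by ring
      rw [h5, h4, h3] at h2
      linarith
  have h := Finset.sum_le_sum fun a (_ : a ∈ Finset.univ) => key a
  rw [Finset.sum_sub_distrib, Finset.sum_sub_distrib, ← Finset.sum_mul, hp.2, ← Finset.mul_sum,
    ← Finset.mul_sum, Finset.sum_sub_distrib, hp.2, (softmax_mem_stdSimplex τ q).2] at h
  unfold negEntropy dotProduct
  linarith

theorem softmax_dotProduct_sub_negEntropy (hτ : 0 < τ) (q : A → ℝ) :
    softmax τ q ⬝ᵥ q - τ * negEntropy (softmax τ q) = lse τ q := by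
  have h : ∀ a, softmax τ q a * q a - τ * (softmax τ q a * Real.log (softmax τ q a)) =
      softmax τ q a * lse τ q := by
    intro a
    have h4 := mul_log_softmax hτ q a
    linear_combination (-softmax τ q a) * h4
  unfold negEntropy dotProduct
  rw [Finset.mul_sum, ← Finset.sum_sub_distrib, Finset.sum_congr rfl fun a _ => h a,
    ← Finset.sum_mul, (softmax_mem_stdSimplex τ q).2, one_mul]

/-- `lse τ` is smooth with respect to the sup norm, with gradient `softmax τ`. -/
theorem lse_add_le (hτ : 0 < τ) (q δ : A → ℝ) {s : ℝ} (hs : s ≤ τ) (hδ : ∀ a, |δ a| ≤ s) :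
    lse τ (q + δ) ≤ lse τ q + softmax τ q ⬝ᵥ δ + s ^ 2 / τ := by
  have hZ := sum_exp_pos τ q
  have hterm : ∀ a, Real.exp ((q + δ) a / τ) ≤
      Real.exp (q a / τ) * (1 + δ a / τ + (s / τ) ^ 2) := by
    intro a
    rw [Pi.add_apply, add_div, Real.exp_add]
    refine mul_le_mul_of_nonneg_left ?_ (Real.exp_pos _).le
    have h1 : |δ a / τ| ≤ s / τ := by rw [abs_div, abs_of_pos hτ]; gcongr; exact hδ a
    have h2 : s / τ ≤ 1 := (div_le_one hτ).2 hs
    have h3 := (abs_le.1 (Real.abs_exp_sub_one_sub_id_le (h1.trans h2))).2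
    have h4 : (δ a / τ) ^ 2 ≤ (s / τ) ^ 2 := sq_le_sq' (by linarith [(abs_le.1 h1).1])
      (abs_le.1 h1).2
    linarith
  have hsum : ∑ a, Real.exp ((q + δ) a / τ) ≤
      (∑ a, Real.exp (q a / τ)) * (1 + (softmax τ q ⬝ᵥ δ / τ + (s / τ) ^ 2)) := by
    refine (Finset.sum_le_sum fun a _ => hterm a).trans (le_of_eq ?_)
    have h : (∑ a, Real.exp (q a / τ)) * (softmax τ q ⬝ᵥ δ / τ) =
        ∑ a, Real.exp (q a / τ) * (δ a / τ) := by
      unfold softmax dotProduct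
      rw [Finset.sum_div, Finset.mul_sum]
      refine Finset.sum_congr rfl fun a _ => ?_
      field_simp
    rw [mul_add, mul_add, h, mul_one, Finset.sum_mul, ← Finset.sum_add_distrib,
      ← Finset.sum_add_distrib]
    exact Finset.sum_congr rfl fun a _ => by ring
  have hpos : 0 < 1 + (softmax τ q ⬝ᵥ δ / τ + (s / τ) ^ 2) :=
    pos_of_mul_pos_right ((sum_exp_pos τ (q + δ)).trans_le hsum) hZ.le
  have hlog := Real.log_le_log (sum_exp_pos τ (q + δ)) hsum
  rw [Real.log_mul hZ.ne' hpos.ne'] at hlog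
  have h5 := Real.log_le_sub_one_of_pos hpos
  have h6 : Real.log (∑ a, Real.exp ((q + δ) a / τ)) ≤
      Real.log (∑ a, Real.exp (q a / τ)) + (softmax τ q ⬝ᵥ δ / τ + (s / τ) ^ 2) := by linarith
  have h7 := mul_le_mul_of_nonneg_left h6 hτ.le
  have h8 : τ * (Real.log (∑ a, Real.exp (q a / τ)) + (softmax τ q ⬝ᵥ δ / τ + (s / τ) ^ 2)) =
      lse τ q + softmax τ q ⬝ᵥ δ + s ^ 2 / τ := by
    unfold lse; field_simp; ring
  rw [h8] at h7
  exact h7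

/-- A form of Pinsker's inequality: the right-hand side is `τ` times the Kullback-Leibler divergence
of `p` from `softmax τ q`. It is dual to the smoothness of `lse τ`. -/
theorem pinsker_softmax (hτ : 0 < τ) {p : A → ℝ} (hp : p ∈ stdSimplex ℝ A) (q : A → ℝ) :
    τ / 4 * (∑ a, |p a - softmax τ q a|) ^ 2 ≤ lse τ q - p ⬝ᵥ q + τ * negEntropy p := by
  set d := ∑ a, |p a - softmax τ q a| with hd
  have hd0 : 0 ≤ d := Finset.sum_nonneg fun a _ => abs_nonneg _
  have hd2 : d ≤ 2 := sum_abs_sub_le_two hp (softmax_mem_stdSimplex τ q)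
  -- Test smoothness and the Gibbs inequality in the direction dual to `p - softmax τ q`.
  let δ : A → ℝ := fun a => τ * d / 2 * SignType.sign (p a - softmax τ q a)
  have hδ : ∀ a, |δ a| ≤ τ * d / 2 := by
    intro a
    have h : |((SignType.sign (p a - softmax τ q a) : SignType) : ℝ)| ≤ 1 := by
      rcases lt_trichotomy (p a - softmax τ q a) 0 with h | h | h <;> simp [h]
    simp only [δ, abs_mul]
    rw [abs_of_nonneg (by positivity : 0 ≤ τ * d / 2)]
    exact mul_le_of_le_one_right (by positivity) h
  have h1 := lse_add_le hτ q δ (by nlinarith) hδ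
  have h2 := dotProduct_sub_negEntropy_le_lse hτ hp (q + δ)
  have h3 : p ⬝ᵥ δ - softmax τ q ⬝ᵥ δ = τ * d ^ 2 / 2 := by
    rw [← sub_dotProduct, show τ * d ^ 2 / 2 = τ * d / 2 * d by ring]
    nth_rewrite 2 [hd]
    rw [dotProduct, Finset.mul_sum]
    refine Finset.sum_congr rfl fun a _ => ?_
    simp only [δ, Pi.sub_apply]
    rw [← self_mul_sign (p a - softmax τ q a)]
    ring
  rw [dotProduct_add] at h2
  have h4 : (τ * d / 2) ^ 2 / τ = τ * d ^ 2 / 4 := by field_simp; norm_num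
  linarith

/-- The softmax is Lipschitz from the sup norm to the `ℓ¹` norm. -/
theorem sum_abs_softmax_sub_le (hτ : 0 < τ) (q q' : A → ℝ) {s : ℝ} (hs : 0 ≤ s)
    (h : ∀ a, |q a - q' a| ≤ s) : ∑ a, |softmax τ q a - softmax τ q' a| ≤ 2 * s / τ := by
  have h1 := pinsker_softmax hτ (softmax_mem_stdSimplex τ q) q'
  have h2 := pinsker_softmax hτ (softmax_mem_stdSimplex τ q') q
  have e1 := softmax_dotProduct_sub_negEntropy hτ q
  have e2 := softmax_dotProduct_sub_negEntropy hτ q'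
  have e3 : ∑ a, |softmax τ q' a - softmax τ q a| = ∑ a, |softmax τ q a - softmax τ q' a| :=
    Finset.sum_congr rfl fun a _ => abs_sub_comm _ _
  rw [e3] at h2
  set d := ∑ a, |softmax τ q a - softmax τ q' a| with hd
  have hd0 : 0 ≤ d := Finset.sum_nonneg fun a _ => abs_nonneg _
  have h3 : (softmax τ q - softmax τ q') ⬝ᵥ (q - q') ≤ d * s :=
    (le_abs_self _).trans (abs_dotProduct_le h)
  simp only [sub_dotProduct, dotProduct_sub] at h3
  rcases hd0.eq_or_lt with h0 | h0
  · rw [← h0]; positivity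
  · have h4 : d * (τ * d) ≤ d * (2 * s) := by nlinarith
    rw [le_div_iff₀ hτ, mul_comm]
    exact le_of_mul_le_mul_left h4 h0

end Softmax

/-! ### The regularized Nash gap and its drift -/

section Drift

variable {A B : Type*} [Fintype A] [Fintype B] {τ : ℝ}

theorem dotProduct_mulVec_eq_neg (R : Matrix A B ℝ) (x : A → ℝ) (y : B → ℝ) :
    x ⬝ᵥ (R *ᵥ y) = -(y ⬝ᵥ ((-Rᵀ) *ᵥ x)) := by
  rw [neg_mulVec, dotProduct_neg, neg_neg, mulVec_transpose, dotProduct_mulVec, dotProduct_comm]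

theorem abs_neg_transpose_le {A B : Type*} {R : Matrix A B ℝ} (hR : ∀ a b, |R a b| ≤ 1) (b : B)
    (a : A) :
    |(-Rᵀ) b a| ≤ 1 := by
  simpa using hR a b

theorem abs_mulVec_le {A B : Type*} [Fintype B] {R : Matrix A B ℝ} (hR : ∀ a b, |R a b| ≤ 1)
    (y : B → ℝ) (a : A) :
    |(R *ᵥ y) a| ≤ ∑ b, |y b| := by
  rw [mulVec, dotProduct_comm]
  simpa using abs_dotProduct_le (x := y) (hR a)

/-- The regularized Nash gap: the sum over the players of the largest gain from deviating in the
game whose payoffs are augmented by `τ` times the entropy of the player's own policy. The bilinear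
terms of the two players cancel, so they do not appear. -/
noncomputable def regGap (τ : ℝ) (R : Matrix A B ℝ) (π : A → ℝ) (π' : B → ℝ) : ℝ :=
  (lse τ (R *ᵥ π') + τ * negEntropy π) + (lse τ ((-Rᵀ) *ᵥ π) + τ * negEntropy π')

theorem deviationGain_le [Nonempty A] {R : Matrix A B ℝ} {π : A → ℝ} {π' : B → ℝ} {M : ℝ}
    (hM : ∀ a, (R *ᵥ π') a ≤ M) : deviationGain R π π' ≤ M - π ⬝ᵥ (R *ᵥ π') := by
  classical
  refine csSup_le (Set.Nonempty.image _ ⟨_, single_mem_stdSimplex ℝ (Classical.arbitrary A)⟩) ?_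
  rintro _ ⟨p, hp, rfl⟩
  simp only [sub_dotProduct]
  linarith [dotProduct_le_of_mem_stdSimplex hp hM]

/-- The Nash gap of a zero-sum game is at most the sum of upper bounds of the two best-response
values. -/
theorem nashGap_le [Nonempty A] [Nonempty B] {R : Matrix A B ℝ} {π : A → ℝ} {π' : B → ℝ} {M M' : ℝ}
    (hM : ∀ a, (R *ᵥ π') a ≤ M) (hM' : ∀ b, ((-Rᵀ) *ᵥ π) b ≤ M') :
    nashGap R π π' ≤ M + M' := by
  have h1 := deviationGain_le (π := π) hM
  have h2 := deviationGain_le (π := π') hM'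
  have h3 := dotProduct_mulVec_eq_neg R π π'
  unfold nashGap
  linarith

theorem nashGap_le_two [Nonempty A] [Nonempty B] {R : Matrix A B ℝ} (hR : ∀ a b, |R a b| ≤ 1)
    {π : A → ℝ} {π' : B → ℝ}
    (hπ : π ∈ stdSimplex ℝ A) (hπ' : π' ∈ stdSimplex ℝ B) : nashGap R π π' ≤ 2 := by
  have h1 : ∀ a, (R *ᵥ π') a ≤ 1 := fun a => by
    rw [← sum_abs_of_mem_stdSimplex hπ']
    exact (le_abs_self _).trans (abs_mulVec_le hR π' a)
  have h2 : ∀ b, ((-Rᵀ) *ᵥ π) b ≤ 1 := fun b => by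
    rw [← sum_abs_of_mem_stdSimplex hπ]
    exact (le_abs_self _).trans (abs_mulVec_le (abs_neg_transpose_le hR) π b)
  linarith [nashGap_le h1 h2]

theorem nashGap_nonpos_of_subsingleton [Nonempty A] [Nonempty B] [Subsingleton A] [Subsingleton B]
    {R : Matrix A B ℝ}
    {π : A → ℝ} {π' : B → ℝ} (hπ : π ∈ stdSimplex ℝ A) (hπ' : π' ∈ stdSimplex ℝ B) :
    nashGap R π π' ≤ 0 := by
  obtain ⟨a⟩ := ‹Nonempty A›
  obtain ⟨b⟩ := ‹Nonempty B›
  have h1 : ∀ a', (R *ᵥ π') a' ≤ (R *ᵥ π') a := fun a' => by rw [Subsingleton.elim a' a]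
  have h2 : ∀ b', ((-Rᵀ) *ᵥ π) b' ≤ ((-Rᵀ) *ᵥ π) b := fun b' => by rw [Subsingleton.elim b' b]
  have h3 := nashGap_le h1 h2
  have h4 := dotProduct_le_of_mem_stdSimplex hπ (y := -(R *ᵥ π')) (M := -(R *ᵥ π') a)
    fun a' => by rw [Subsingleton.elim a' a]; rfl
  have h5 := dotProduct_le_of_mem_stdSimplex hπ' (y := -((-Rᵀ) *ᵥ π)) (M := -((-Rᵀ) *ᵥ π) b)
    fun b' => by rw [Subsingleton.elim b' b]; rfl
  rw [dotProduct_neg] at h4 h5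
  linarith [dotProduct_mulVec_eq_neg R π π']

theorem nashGap_le_regGap_add [Nonempty A] [Nonempty B] (hτ : 0 < τ) {R : Matrix A B ℝ} {π : A → ℝ}
    {π' : B → ℝ}
    (hπ : π ∈ stdSimplex ℝ A) (hπ' : π' ∈ stdSimplex ℝ B) :
    nashGap R π π' ≤ regGap τ R π π' + 2 * τ * Real.log (maxActions A B) := by
  have h := nashGap_le (le_lse hτ (R *ᵥ π')) (le_lse hτ ((-Rᵀ) *ᵥ π))
  have hA : Real.log (Fintype.card A) ≤ Real.log (maxActions A B) :=
    Real.log_le_log (by exact_mod_cast Fintype.card_pos) (by exact_mod_cast le_max_left _ _)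
  have hB : Real.log (Fintype.card B) ≤ Real.log (maxActions A B) :=
    Real.log_le_log (by exact_mod_cast Fintype.card_pos) (by exact_mod_cast le_max_right _ _)
  have h1 := mul_le_mul_of_nonneg_left (neg_log_card_le_negEntropy hπ) hτ.le
  have h2 := mul_le_mul_of_nonneg_left (neg_log_card_le_negEntropy hπ') hτ.le
  have h3 := mul_le_mul_of_nonneg_left hA hτ.le
  have h4 := mul_le_mul_of_nonneg_left hB hτ.le
  unfold regGap
  linarith

theorem uniform_mem_stdSimplex (A : Type*) [Fintype A] [Nonempty A] :
    (fun _ : A => 1 / (Fintype.card A : ℝ)) ∈ stdSimplex ℝ A :=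
  ⟨fun _ => by positivity, by simp⟩

theorem regGap_uniform_le_two [Nonempty A] [Nonempty B] (hτ : 0 < τ) {R : Matrix A B ℝ}
    (hR : ∀ a b, |R a b| ≤ 1) :
    regGap τ R (fun _ => 1 / (Fintype.card A : ℝ)) (fun _ => 1 / (Fintype.card B : ℝ)) ≤ 2 := by
  have h1 : ∀ a, (R *ᵥ (fun _ => 1 / (Fintype.card B : ℝ))) a ≤ 1 := fun a => by
    have h := (le_abs_self _).trans (abs_mulVec_le hR (fun _ => 1 / (Fintype.card B : ℝ)) a)
    rwa [sum_abs_of_mem_stdSimplex (uniform_mem_stdSimplex B)] at h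
  have h2 : ∀ b, ((-Rᵀ) *ᵥ (fun _ => 1 / (Fintype.card A : ℝ))) b ≤ 1 := fun b => by
    have h := (le_abs_self _).trans (abs_mulVec_le (abs_neg_transpose_le hR)
      (fun _ => 1 / (Fintype.card A : ℝ)) b)
    rwa [sum_abs_of_mem_stdSimplex (uniform_mem_stdSimplex A)] at h
  have h3 := lse_le hτ h1
  have h4 := lse_le hτ h2
  unfold regGap
  rw [negEntropy_uniform, negEntropy_uniform]
  linarith

/-- The regularized Nash gap controls the distances of the policies to the smoothed best
responses. -/
theorem sq_dist_le_regGap [Nonempty A] [Nonempty B] (hτ : 0 < τ) (R : Matrix A B ℝ) {π : A → ℝ}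
    {π' : B → ℝ}
    (hπ : π ∈ stdSimplex ℝ A) (hπ' : π' ∈ stdSimplex ℝ B) :
    τ / 4 * ((∑ a, |π a - softmax τ (R *ᵥ π') a|) ^ 2 +
      (∑ b, |π' b - softmax τ ((-Rᵀ) *ᵥ π) b|) ^ 2) ≤ regGap τ R π π' := by
  have h1 := pinsker_softmax hτ hπ (R *ᵥ π')
  have h2 := pinsker_softmax hτ hπ' ((-Rᵀ) *ᵥ π)
  have h3 := dotProduct_mulVec_eq_neg R π π'
  unfold regGap
  linarith

theorem regGap_nonneg [Nonempty A] [Nonempty B] (hτ : 0 < τ) (R : Matrix A B ℝ) {π : A → ℝ}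
    {π' : B → ℝ}
    (hπ : π ∈ stdSimplex ℝ A) (hπ' : π' ∈ stdSimplex ℝ B) : 0 ≤ regGap τ R π π' :=
  le_trans (by positivity) (sq_dist_le_regGap hτ R hπ hπ')

theorem convexComb_mem_stdSimplex {p p' : A → ℝ} (hp : p ∈ stdSimplex ℝ A)
    (hp' : p' ∈ stdSimplex ℝ A) {β : ℝ} (h0 : 0 ≤ β) (h1 : β ≤ 1) :
    (fun a => p a + β * (p' a - p a)) ∈ stdSimplex ℝ A := by
  refine ⟨fun a => ?_, ?_⟩
  · nlinarith [hp.1 a, hp'.1 a]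
  · rw [Finset.sum_add_distrib, ← Finset.mul_sum, Finset.sum_sub_distrib, hp.2, hp'.2]
    ring

/-- The terms of the regularized Nash gap that belong to one player, after one step of both
policies. -/
theorem lse_add_negEntropy_step_le [Nonempty A] (hτ : 0 < τ) {R : Matrix A B ℝ}
    (hR : ∀ a b, |R a b| ≤ 1)
    {π : A → ℝ} {π' : B → ℝ} (hπ : π ∈ stdSimplex ℝ A) (hπ' : π' ∈ stdSimplex ℝ B)
    (q : A → ℝ) {σ' : B → ℝ} (hσ' : σ' ∈ stdSimplex ℝ B) {β : ℝ} (h0 : 0 ≤ β) (h1 : β ≤ 1)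
    (hβ : 2 * β ≤ τ) :
    lse τ (R *ᵥ fun b => π' b + β * (σ' b - π' b)) +
        τ * negEntropy (fun a => π a + β * (softmax τ q a - π a)) ≤
      (1 - β) * (lse τ (R *ᵥ π') + τ * negEntropy π) +
        β * (softmax τ (R *ᵥ π') ⬝ᵥ (R *ᵥ σ') +
          (softmax τ q - softmax τ (R *ᵥ π')) ⬝ᵥ q) + 4 * β ^ 2 / τ := by
  have e1 : (fun b => π' b + β * (σ' b - π' b)) = π' + β • (σ' - π') := by
    ext b; simp
  have h2 : ∀ a, |(β • (R *ᵥ (σ' - π'))) a| ≤ 2 * β := by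
    intro a
    rw [Pi.smul_apply, smul_eq_mul, abs_mul, abs_of_nonneg h0, mul_comm]
    exact mul_le_mul_of_nonneg_right ((abs_mulVec_le hR _ a).trans (sum_abs_sub_le_two hσ' hπ')) h0
  have h3 := lse_add_le hτ (R *ᵥ π') _ hβ h2
  have h4 := mul_le_mul_of_nonneg_left
    (negEntropy_convex_comb hπ (softmax_mem_stdSimplex τ q) h0 h1) hτ.le
  have h5 := softmax_dotProduct_sub_negEntropy hτ (R *ᵥ π')
  have h6 := softmax_dotProduct_sub_negEntropy hτ q
  have h7 := dotProduct_sub_negEntropy_le_lse hτ (softmax_mem_stdSimplex τ (R *ᵥ π')) q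
  rw [e1, mulVec_add, mulVec_smul]
  rw [dotProduct_smul, smul_eq_mul, mulVec_sub, dotProduct_sub] at h3
  rw [mulVec_sub, sub_dotProduct]
  have h8 : β * (τ * negEntropy (softmax τ q)) ≤ β * (softmax τ q ⬝ᵥ q -
      softmax τ (R *ᵥ π') ⬝ᵥ q + τ * negEntropy (softmax τ (R *ᵥ π'))) :=
    mul_le_mul_of_nonneg_left (by linarith) h0
  have h9 : (2 * β) ^ 2 / τ = 4 * β ^ 2 / τ := by ring
  rw [← h5] at h3 ⊢
  nlinarith

/-- The squared error of the estimate `q` of the payoff vector `R *ᵥ π'`. -/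
noncomputable def qError (R : Matrix A B ℝ) (q : A → ℝ) (π' : B → ℝ) : ℝ :=
  ∑ a, (q a - (R *ᵥ π') a) ^ 2

theorem qError_nonneg (R : Matrix A B ℝ) (q : A → ℝ) (π' : B → ℝ) : 0 ≤ qError R q π' :=
  Finset.sum_nonneg fun _ _ => sq_nonneg _

theorem abs_sub_le_sqrt_qError (R : Matrix A B ℝ) (q : A → ℝ) (π' : B → ℝ) (a : A) :
    |q a - (R *ᵥ π') a| ≤ √(qError R q π') :=
  Real.abs_le_sqrt (Finset.single_le_sum (f := fun a => (q a - (R *ᵥ π') a) ^ 2)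
    (fun _ _ => sq_nonneg _) (Finset.mem_univ a))

/-- The error of the smoothed best response to `q` in place of the exact payoffs. -/
theorem best_response_error_le [Nonempty A] (hτ : 0 < τ) {R : Matrix A B ℝ}
    (hR : ∀ a b, |R a b| ≤ 1)
    (π' σ' : B → ℝ) (q : A → ℝ) :
    (softmax τ q - softmax τ (R *ᵥ π')) ⬝ᵥ (q - R *ᵥ σ') ≤
      (2 / τ + 16 / τ ^ 3) * qError R q π' + τ / 16 * (∑ b, |π' b - σ' b|) ^ 2 := by
  set s := √(qError R q π') with hs
  have hs0 : 0 ≤ s := Real.sqrt_nonneg _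
  have hs2 : s ^ 2 = qError R q π' := Real.sq_sqrt (qError_nonneg R q π')
  set d := ∑ b, |π' b - σ' b| with hd
  have hd0 : 0 ≤ d := Finset.sum_nonneg fun _ _ => abs_nonneg _
  have h1 : ∀ a, |(q - R *ᵥ σ') a| ≤ s + d := by
    intro a
    have e : (q - R *ᵥ σ') a = (q a - (R *ᵥ π') a) + (R *ᵥ (π' - σ')) a := by
      rw [mulVec_sub]; simp
    rw [e]
    exact (abs_add_le _ _).trans (add_le_add (abs_sub_le_sqrt_qError R q π' a)
      (abs_mulVec_le hR _ a))
  have h2 := sum_abs_softmax_sub_le hτ q (R *ᵥ π') hs0 (abs_sub_le_sqrt_qError R q π')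
  have h3 : (softmax τ q - softmax τ (R *ᵥ π')) ⬝ᵥ (q - R *ᵥ σ') ≤ 2 * s / τ * (s + d) :=
    ((le_abs_self _).trans (abs_dotProduct_le h1)).trans
      (mul_le_mul_of_nonneg_right h2 (by positivity))
  refine h3.trans ?_
  rw [← hs2]
  have h4 : (2 / τ + 16 / τ ^ 3) * s ^ 2 + τ / 16 * d ^ 2 - 2 * s / τ * (s + d) =
      τ / 16 * (d - 16 * s / τ ^ 2) ^ 2 := by
    field_simp; ring
  have : 0 ≤ τ / 16 * (d - 16 * s / τ ^ 2) ^ 2 := by positivity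
  linarith

/-- The drift of the regularized Nash gap in one step of the policies. -/
theorem regGap_step_le [Nonempty A] [Nonempty B] (hτ : 0 < τ) (hτ' : τ ≤ 3 / 2) {R : Matrix A B ℝ}
    (hR : ∀ a b, |R a b| ≤ 1) {π : A → ℝ} {π' : B → ℝ} (hπ : π ∈ stdSimplex ℝ A)
    (hπ' : π' ∈ stdSimplex ℝ B) (q : A → ℝ) (q' : B → ℝ) {β : ℝ} (h0 : 0 ≤ β) (h1 : β ≤ 1)
    (hβ : 2 * β ≤ τ) :
    regGap τ R (fun a => π a + β * (softmax τ q a - π a))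
        (fun b => π' b + β * (softmax τ q' b - π' b)) ≤
      (1 - 3 / 4 * β) * regGap τ R π π' +
        β * (21 / τ ^ 3) * (qError R q π' + qError (-Rᵀ) q' π) + 8 * β ^ 2 / τ := by
  have hS := abs_neg_transpose_le hR
  have a1 := lse_add_negEntropy_step_le hτ hR hπ hπ' q (softmax_mem_stdSimplex τ q') h0 h1 hβ
  have a2 := lse_add_negEntropy_step_le hτ hS hπ' hπ q' (softmax_mem_stdSimplex τ q) h0 h1 hβ
  have b1 := best_response_error_le hτ hR π' (softmax τ ((-Rᵀ) *ᵥ π)) q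
  have b2 := best_response_error_le hτ hS π (softmax τ (R *ᵥ π')) q'
  have c1 := sq_dist_le_regGap hτ R hπ hπ'
  simp only [sub_dotProduct, dotProduct_sub] at b1 b2 a1 a2
  -- The zero-sum structure turns the cross terms into errors of the smoothed best responses.
  have z1 := dotProduct_mulVec_eq_neg R (softmax τ (R *ᵥ π')) (softmax τ q')
  have z2 := dotProduct_mulVec_eq_neg R (softmax τ q) (softmax τ ((-Rᵀ) *ᵥ π))
  have z3 := dotProduct_mulVec_eq_neg R (softmax τ (R *ᵥ π')) (softmax τ ((-Rᵀ) *ᵥ π))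
  have hE : 0 ≤ qError R q π' + qError (-Rᵀ) q' π :=
    add_nonneg (qError_nonneg _ _ _) (qError_nonneg _ _ _)
  have hc : (2 / τ + 16 / τ ^ 3) ≤ 21 / τ ^ 3 := by
    rw [show 2 / τ + 16 / τ ^ 3 = (2 * τ ^ 2 + 16) / τ ^ 3 by field_simp]
    gcongr
    nlinarith
  have d1 := mul_le_mul_of_nonneg_right hc hE
  have key : softmax τ (R *ᵥ π') ⬝ᵥ (R *ᵥ softmax τ q') +
      (softmax τ q ⬝ᵥ q - softmax τ (R *ᵥ π') ⬝ᵥ q) +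
      (softmax τ ((-Rᵀ) *ᵥ π) ⬝ᵥ ((-Rᵀ) *ᵥ softmax τ q) +
      (softmax τ q' ⬝ᵥ q' - softmax τ ((-Rᵀ) *ᵥ π) ⬝ᵥ q')) ≤
      1 / 4 * regGap τ R π π' + 21 / τ ^ 3 * (qError R q π' + qError (-Rᵀ) q' π) := by
    linarith
  have key' := mul_le_mul_of_nonneg_left key h0
  have e : 8 * β ^ 2 / τ = 4 * β ^ 2 / τ + 4 * β ^ 2 / τ := by ring
  have hreg : regGap τ R π π' = (lse τ (R *ᵥ π') + τ * negEntropy π) +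
    (lse τ ((-Rᵀ) *ᵥ π) + τ * negEntropy π') := rfl
  rw [e, show regGap τ R (fun a => π a + β * (softmax τ q a - π a))
        (fun b => π' b + β * (softmax τ q' b - π' b)) = _ from rfl]
  unfold regGap at key' ⊢
  linarith

/-! ### The error of the payoff estimates -/

/-- The error of the payoff estimate after the opponent's policy has moved. -/
theorem qError_shift_le {R : Matrix A B ℝ} (hR : ∀ a b, |R a b| ≤ 1) (q : A → ℝ)
    (π' σ' : B → ℝ) (β : ℝ) {η : ℝ} (hη : 0 < η) :
    qError R q (fun b => π' b + β * (σ' b - π' b)) ≤ (1 + η) * qError R q π' +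
      (1 + 1 / η) * (Fintype.card A * (β ^ 2 * (∑ b, |σ' b - π' b|) ^ 2)) := by
  have e1 : (fun b => π' b + β * (σ' b - π' b)) = π' + β • (σ' - π') := by
    ext b; simp
  have hterm : ∀ a, (q a - (R *ᵥ fun b => π' b + β * (σ' b - π' b)) a) ^ 2 ≤
      (1 + η) * (q a - (R *ᵥ π') a) ^ 2 +
        (1 + 1 / η) * (β ^ 2 * (∑ b, |σ' b - π' b|) ^ 2) := by
    intro a
    rw [e1, mulVec_add, mulVec_smul]
    simp only [Pi.add_apply, Pi.smul_apply, smul_eq_mul]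
    have h1 := abs_mulVec_le hR (σ' - π') a
    simp only [Pi.sub_apply] at h1
    have h2 := sq_le_sq' (by linarith [(abs_le.1 h1).1]) (abs_le.1 h1).2
    set x := q a - (R *ᵥ π') a
    set y := (R *ᵥ (σ' - π')) a
    have h3 : (1 + η) * x ^ 2 + (1 + 1 / η) * (β ^ 2 * y ^ 2) - (x - β * y) ^ 2 =
        (η * x + β * y) ^ 2 / η := by
      field_simp; ring
    have h4 : 0 ≤ (η * x + β * y) ^ 2 / η := by positivity
    have h5 : (1 + 1 / η) * (β ^ 2 * y ^ 2) ≤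
        (1 + 1 / η) * (β ^ 2 * (∑ b, |σ' b - π' b|) ^ 2) := by gcongr
    have h6 : q a - ((R *ᵥ π') a + β * y) = x - β * y := by simp only [x]; ring
    rw [h6]
    linarith
  unfold qError
  refine (Finset.sum_le_sum fun a _ => hterm a).trans (le_of_eq ?_)
  rw [Finset.sum_add_distrib, ← Finset.mul_sum, Finset.sum_const, Finset.card_univ, nsmul_eq_mul]
  ring

/-- The expected error after one update of `q`, when the actions are sampled from `π` and `π'`. -/
theorem sum_qError_update_le [DecidableEq A] {R : Matrix A B ℝ} (hR : ∀ a b, |R a b| ≤ 1)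
    {π : A → ℝ} {π' : B → ℝ} (hπ : π ∈ stdSimplex ℝ A) (hπ' : π' ∈ stdSimplex ℝ B) {ℓ : ℝ}
    (hℓ : ∀ a, ℓ ≤ π a) {q : A → ℝ} (hq : ∀ a, |q a| ≤ 1) {α : ℝ} (hα : 0 ≤ α) :
    ∑ a, ∑ b, π a * π' b *
        qError R (fun a' => q a' + α * (if a' = a then R a b - q a else 0)) π' ≤
      (1 - 2 * α * ℓ) * qError R q π' + 4 * α ^ 2 := by
  set m := R *ᵥ π' with hm
  have hexp : ∀ a b, qError R (fun a' => q a' + α * (if a' = a then R a b - q a else 0)) π' =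
      qError R q π' + 2 * α * ((q a - m a) * (R a b - q a)) + α ^ 2 * (R a b - q a) ^ 2 := by
    intro a b
    have h : ∀ a', (q a' + α * (if a' = a then R a b - q a else 0) - m a') ^ 2 =
        (q a' - m a') ^ 2 + if a' = a then
          2 * α * ((q a - m a) * (R a b - q a)) + α ^ 2 * (R a b - q a) ^ 2 else 0 := by
      intro a'
      split_ifs with h
      · subst h; ring
      · ring
    unfold qError
    rw [Finset.sum_congr rfl fun a' _ => h a', Finset.sum_add_distrib, Finset.sum_ite_eq',
      if_pos (Finset.mem_univ a)]
    ring
  have hbd : ∀ a b, qError R (fun a' => q a' + α * (if a' = a then R a b - q a else 0)) π' ≤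
      qError R q π' + 2 * α * ((q a - m a) * (R a b - q a)) + 4 * α ^ 2 := by
    intro a b
    have h1 := abs_le.1 (hR a b)
    have h2 := abs_le.1 (hq a)
    have h3 : (R a b - q a) ^ 2 ≤ 2 ^ 2 := sq_le_sq' (by linarith) (by linarith)
    rw [hexp]
    nlinarith [sq_nonneg α]
  have hb : ∀ a, ∑ b, π a * π' b *
        qError R (fun a' => q a' + α * (if a' = a then R a b - q a else 0)) π' ≤
      π a * (qError R q π' + 4 * α ^ 2) - 2 * α * (π a * (q a - m a) ^ 2) := by
    intro a
    have hma : m a = ∑ b, π' b * R a b := by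
      rw [hm]; exact Finset.sum_congr rfl fun b _ => mul_comm _ _
    calc _ ≤ ∑ b, π a * π' b *
          (qError R q π' + 2 * α * ((q a - m a) * (R a b - q a)) + 4 * α ^ 2) :=
          Finset.sum_le_sum fun b _ => mul_le_mul_of_nonneg_left (hbd a b)
            (mul_nonneg (hπ.1 a) (hπ'.1 b))
      _ = ∑ b, (π' b * (π a * (qError R q π' + 4 * α ^ 2 - 2 * α * (q a - m a) * q a)) +
          π' b * R a b * (2 * α * π a * (q a - m a))) :=
          Finset.sum_congr rfl fun b _ => by ring
      _ = _ := by
          rw [Finset.sum_add_distrib, ← Finset.sum_mul, ← Finset.sum_mul, hπ'.2, ← hma]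
          ring
  have hlow : ℓ * qError R q π' ≤ ∑ a, π a * (q a - m a) ^ 2 := by
    unfold qError
    rw [Finset.mul_sum]
    exact Finset.sum_le_sum fun a _ => mul_le_mul_of_nonneg_right (hℓ a) (sq_nonneg _)
  refine (Finset.sum_le_sum fun a _ => hb a).trans ?_
  rw [Finset.sum_sub_distrib, ← Finset.sum_mul, hπ.2, ← Finset.mul_sum]
  nlinarith

/-- A policy that is close to its smoothed best response moves slowly, if the estimates are good. -/
theorem sq_sum_abs_softmax_sub_le [Nonempty A] (hτ : 0 < τ) (R : Matrix A B ℝ) (q : A → ℝ)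
    (π : A → ℝ)
    (π' : B → ℝ) :
    (∑ a, |softmax τ q a - π a|) ^ 2 ≤
      2 * (∑ a, |π a - softmax τ (R *ᵥ π') a|) ^ 2 + 8 / τ ^ 2 * qError R q π' := by
  set s := √(qError R q π') with hs
  have hs0 : 0 ≤ s := Real.sqrt_nonneg _
  have hs2 : s ^ 2 = qError R q π' := Real.sq_sqrt (qError_nonneg R q π')
  have h2 := sum_abs_softmax_sub_le hτ q (R *ᵥ π') hs0 (abs_sub_le_sqrt_qError R q π')
  have h3 : ∑ a, |softmax τ q a - π a| ≤
      2 * s / τ + ∑ a, |π a - softmax τ (R *ᵥ π') a| := by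
    refine le_trans ?_ (add_le_add_left h2 _)
    rw [← Finset.sum_add_distrib]
    refine Finset.sum_le_sum fun a _ => ?_
    rw [abs_sub_comm (π a)]
    exact abs_sub_le _ _ _
  set d := ∑ a, |π a - softmax τ (R *ᵥ π') a|
  have h4 : 0 ≤ ∑ a, |softmax τ q a - π a| := Finset.sum_nonneg fun _ _ => abs_nonneg _
  have h5 := pow_le_pow_left₀ h4 h3 2
  refine h5.trans ?_
  rw [← hs2]
  have : 8 / τ ^ 2 * s ^ 2 = 2 * (2 * s / τ) ^ 2 := by ring
  nlinarith [sq_nonneg (2 * s / τ - d)]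

end Drift

/-! ### Invariants of the iterates -/

theorem ell_pos {τ N : ℝ} (hN : 1 ≤ N) : 0 < ell τ N := by
  unfold ell
  have := mul_nonneg (sub_nonneg.2 hN) (Real.exp_pos (2 / τ)).le
  exact inv_pos.2 (by linarith)

theorem ell_le_one {τ N : ℝ} (hN : 1 ≤ N) : ell τ N ≤ 1 := by
  unfold ell
  have := mul_nonneg (sub_nonneg.2 hN) (Real.exp_pos (2 / τ)).le
  exact inv_le_one_of_one_le₀ (by linarith)

theorem ell_le_inv {τ N : ℝ} (hτ : 0 < τ) (hN : 1 ≤ N) : ell τ N ≤ N⁻¹ := by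
  unfold ell
  refine inv_anti₀ (by linarith) ?_
  have h : 1 ≤ Real.exp (2 / τ) := Real.one_le_exp (by positivity)
  nlinarith

theorem ell_le_softmax {A : Type*} [Fintype A] [Nonempty A] {τ N : ℝ} (hτ : 0 < τ)
    (hN : (Fintype.card A : ℝ) ≤ N) {q : A → ℝ} (hq : ∀ a, |q a| ≤ 1) (a : A) :
    ell τ N ≤ softmax τ q a := by
  classical
  have hcard : (1 : ℝ) ≤ Fintype.card A := by exact_mod_cast Fintype.card_pos
  have hZ : ∑ a', Real.exp (q a' / τ) ≤
      Real.exp (q a / τ) * (1 + (N - 1) * Real.exp (2 / τ)) := by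
    rw [← Finset.add_sum_erase _ _ (Finset.mem_univ a)]
    have h : ∀ a' ∈ Finset.univ.erase a,
        Real.exp (q a' / τ) ≤ Real.exp (q a / τ) * Real.exp (2 / τ) := by
      intro a' _
      rw [← Real.exp_add, ← add_div]
      refine Real.exp_le_exp.2 (div_le_div_of_nonneg_right ?_ hτ.le)
      linarith [(abs_le.1 (hq a')).2, (abs_le.1 (hq a)).1]
    have h2 := Finset.sum_le_card_nsmul _ _ _ h
    rw [Finset.card_erase_of_mem (Finset.mem_univ a), Finset.card_univ, nsmul_eq_mul,
      Nat.cast_pred Fintype.card_pos] at h2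
    have h3 : ((Fintype.card A : ℝ) - 1) * (Real.exp (q a / τ) * Real.exp (2 / τ)) ≤
        (N - 1) * (Real.exp (q a / τ) * Real.exp (2 / τ)) := by gcongr
    linarith
  have hpos : 0 < 1 + (N - 1) * Real.exp (2 / τ) := by
    have := mul_nonneg (by linarith : 0 ≤ N - 1) (Real.exp_pos (2 / τ)).le
    linarith
  unfold ell softmax
  rw [le_div_iff₀ (sum_exp_pos τ q), inv_mul_le_iff₀ hpos]
  linarith

/-- The invariants of the iterates of one player: the policy is a probability vector with entries at
least `ℓ`, and the estimates have absolute value at most one. -/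
structure PlayerState.Valid {A : Type*} [Fintype A] (ℓ : ℝ) (s : PlayerState A) : Prop where
  mem : s.policy ∈ stdSimplex ℝ A
  lower : ∀ a, ℓ ≤ s.policy a
  bdd : ∀ a, |s.q a| ≤ 1

theorem PlayerState.valid_init {A : Type*} [Fintype A] [Nonempty A] {τ N : ℝ} (hτ : 0 < τ)
    (hN : (Fintype.card A : ℝ) ≤ N) : (PlayerState.init A).Valid (ell τ N) where
  mem := uniform_mem_stdSimplex A
  lower a := by
    have hcard : (1 : ℝ) ≤ Fintype.card A := by exact_mod_cast Fintype.card_pos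
    refine (ell_le_inv hτ (hcard.trans hN)).trans ?_
    simp only [PlayerState.init, one_div]
    exact inv_anti₀ (by linarith) hN
  bdd a := by simp [PlayerState.init]

theorem PlayerState.Valid.step {A : Type*} [Fintype A] [Nonempty A] [DecidableEq A] {τ N : ℝ}
    (hτ : 0 < τ) (hN : (Fintype.card A : ℝ) ≤ N) {s : PlayerState A} (hs : s.Valid (ell τ N))
    {α β : ℝ} (hα0 : 0 ≤ α) (hα1 : α ≤ 1) (hβ0 : 0 ≤ β) (hβ1 : β ≤ 1) (a : A) {r : ℝ}
    (hr : |r| ≤ 1) : (s.step τ α β a r).Valid (ell τ N) where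
  mem := convexComb_mem_stdSimplex hs.mem (softmax_mem_stdSimplex τ s.q) hβ0 hβ1
  lower a' := by
    have h1 := hs.lower a'
    have h2 := ell_le_softmax hτ hN hs.bdd a'
    simp only [PlayerState.step]
    nlinarith
  bdd a' := by
    simp only [PlayerState.step]
    have h1 := abs_le.1 (hs.bdd a')
    split_ifs with h
    · subst h
      have h2 := abs_le.1 hr
      rw [abs_le]
      constructor <;> nlinarith
    · simpa using hs.bdd a'

/-! ### The Lyapunov function -/

theorem mul_le_of_ratio_le {ℓ τ c N : ℝ} (hℓ0 : 0 < ℓ) (hℓ1 : ℓ ≤ 1) (hτ : 0 < τ) (hc0 : 0 < c)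
    (hN1 : 1 ≤ N) (hc : c ≤ ℓ ^ 3 * τ ^ 3 / (1000 * N ^ 2)) : 1000 * (c * N) ≤ ℓ * τ ^ 3 := by
  rw [le_div_iff₀ (by positivity)] at hc
  have h1 : ℓ ^ 3 * τ ^ 3 ≤ ℓ * τ ^ 3 := by
    have : ℓ ^ 3 ≤ ℓ := by
      have := pow_le_pow_of_le_one hℓ0.le hℓ1 (show 1 ≤ 3 by norm_num)
      simpa using this
    gcongr
  have h2 : c * N ≤ c * N ^ 2 := by
    have : N ≤ N ^ 2 := by nlinarith
    gcongr
  linarith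

theorem two_mul_ratio_le {ℓ τ c N : ℝ} (hℓ0 : 0 < ℓ) (hℓ1 : ℓ ≤ 1) (hτ : 0 < τ)
    (hτ' : τ ≤ 3 / 2) (hc0 : 0 < c) (hN1 : 1 ≤ N) (hcN : 1000 * (c * N) ≤ ℓ * τ ^ 3) :
    2 * c ≤ τ := by
  have hcτ : 1000 * c ≤ ℓ * τ ^ 3 := by
    have : c * 1 ≤ c * N := by gcongr
    linarith
  have hτ2 : τ ^ 2 ≤ 9 / 4 := by nlinarith
  have hcℓτ : 32 * c ≤ ℓ * τ := by
    have : ℓ * τ ^ 3 ≤ ℓ * τ * (9 / 4) := by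
      rw [show ℓ * τ ^ 3 = ℓ * τ * τ ^ 2 by ring]; gcongr
    have : 0 < ℓ * τ := by positivity
    linarith
  have h2 : ℓ * τ ≤ 1 * τ := by gcongr
  linarith

/-- The scalar inequality that combines the drift of the regularized Nash gap `V` with that of the
squared errors `E` of the payoff estimates. -/
theorem lyapunov_scalar_le {ℓ τ c N α V E : ℝ} (hℓ0 : 0 < ℓ) (hℓ1 : ℓ ≤ 1) (hτ : 0 < τ)
    (hτ' : τ ≤ 3 / 2) (hc0 : 0 < c) (hN1 : 1 ≤ N) (hcN : 1000 * (c * N) ≤ ℓ * τ ^ 3) (hα0 : 0 < α)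
    (hreg0 : 0 ≤ V) (hE : 0 ≤ E) :
    (1 - 3 / 4 * (c * α)) * V + c * α * (21 / τ ^ 3) * E + 8 * (c * α) ^ 2 / τ +
      ((1 - α * ℓ / 2) * E + 2 * c ^ 2 * α / ℓ * N * (8 / τ * V + 8 / τ ^ 2 * E) + 8 * α ^ 2) /
        (2 * N) ≤ (1 - c * α / 2) * (V + E / (2 * N)) + 5 * α ^ 2 := by
  have hcτ : 1000 * c ≤ ℓ * τ ^ 3 := by
    have : c * 1 ≤ c * N := by gcongr
    linarith
  have hτ2 : τ ^ 2 ≤ 9 / 4 := by nlinarith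
  have hcℓτ : 32 * c ≤ ℓ * τ := by
    have : ℓ * τ ^ 3 ≤ ℓ * τ * (9 / 4) := by
      rw [show ℓ * τ ^ 3 = ℓ * τ * τ ^ 2 by ring]; gcongr
    have : 0 < ℓ * τ := by positivity
    linarith
  have e1 : (1 - 3 / 4 * (c * α)) * V + c * α * (21 / τ ^ 3) * E + 8 * (c * α) ^ 2 / τ +
      ((1 - α * ℓ / 2) * E + 2 * c ^ 2 * α / ℓ * N * (8 / τ * V + 8 / τ ^ 2 * E) + 8 * α ^ 2) /
        (2 * N) =
      (1 - 3 / 4 * (c * α) + 8 * c * (c * α) / (ℓ * τ)) * V +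
      (1 - α * (ℓ / 2 - 16 * (c * N) * c / (ℓ * τ ^ 2) - 42 * (c * N) / τ ^ 3)) * (E / (2 * N)) +
      (8 * c ^ 2 / τ + 4 / N) * α ^ 2 := by
    field_simp
    ring
  rw [e1]
  have c1 : 8 * c * (c * α) / (ℓ * τ) ≤ c * α / 4 := by
    rw [div_le_iff₀ (by positivity)]
    have := mul_le_mul_of_nonneg_left hcℓτ (show 0 ≤ c * α by positivity)
    linarith
  have c2 : c / 2 ≤ ℓ / 2 - 16 * (c * N) * c / (ℓ * τ ^ 2) - 42 * (c * N) / τ ^ 3 := by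
    have t1 : 42 * (c * N) / τ ^ 3 ≤ 42 / 1000 * ℓ := by
      rw [div_le_iff₀ (by positivity)]; linarith
    have t2 : 16 * (c * N) * c / (ℓ * τ ^ 2) ≤ c := by
      rw [div_le_iff₀ (by positivity)]
      have : 16 * (c * N) ≤ ℓ * τ ^ 2 := by
        have : ℓ * τ ^ 3 ≤ ℓ * τ ^ 2 * (3 / 2) := by
          rw [show ℓ * τ ^ 3 = ℓ * τ ^ 2 * τ by ring]; gcongr
        have : 0 < ℓ * τ ^ 2 := by positivity
        linarith
      nlinarith
    have t3 : ℓ * τ ≤ ℓ * (3 / 2) := by gcongr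
    linarith
  have c3 : 8 * c ^ 2 / τ + 4 / N ≤ 5 := by
    have t1 : 8 * c ^ 2 / τ ≤ 1 := by
      rw [div_le_iff₀ hτ]
      have : ℓ * τ ≤ 1 * τ := by gcongr
      nlinarith
    have t2 : 4 / N ≤ 4 := div_le_self (by norm_num) hN1
    linarith
  have f1 := mul_le_mul_of_nonneg_right c1 hreg0
  have f2 := mul_le_mul_of_nonneg_left c2 hα0.le
  have f3 := mul_le_mul_of_nonneg_right f2 (show 0 ≤ E / (2 * N) by positivity)
  have f4 := mul_le_mul_of_nonneg_right c3 (sq_nonneg α)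
  linarith

section Lyapunov

variable {A B : Type*} [Fintype A] [Fintype B]

/-- The Lyapunov function of the dynamics: the regularized Nash gap of the policies plus the
weighted squared errors of the payoff estimates. The weight makes its initial value at most `3`. -/
noncomputable def lyapunov (τ : ℝ) (R : Matrix A B ℝ) (s : PlayerState A × PlayerState B) : ℝ :=
  regGap τ R s.1.policy s.2.policy +
    (qError R s.1.q s.2.policy + qError (-Rᵀ) s.2.q s.1.policy) / (2 * maxActions A B)

theorem card_left_le_maxActions (A B : Type*) [Fintype A] [Fintype B] :
    (Fintype.card A : ℝ) ≤ maxActions A B := by exact_mod_cast le_max_left _ _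

theorem card_right_le_maxActions (A B : Type*) [Fintype A] [Fintype B] :
    (Fintype.card B : ℝ) ≤ maxActions A B := by exact_mod_cast le_max_right _ _

theorem one_le_maxActions (A B : Type*) [Fintype A] [Fintype B] [Nonempty A] :
    (1 : ℝ) ≤ maxActions A B :=
  le_trans (by exact_mod_cast Fintype.card_pos) (card_left_le_maxActions A B)

theorem qError_zero_le {R : Matrix A B ℝ} (hR : ∀ a b, |R a b| ≤ 1) {π' : B → ℝ}
    (hπ' : π' ∈ stdSimplex ℝ B) : qError R (fun _ => 0) π' ≤ Fintype.card A := by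
  have h : ∀ a, ((fun _ => 0 : A → ℝ) a - (R *ᵥ π') a) ^ 2 ≤ 1 := by
    intro a
    have h1 := abs_mulVec_le hR π' a
    rw [sum_abs_of_mem_stdSimplex hπ'] at h1
    rw [zero_sub, neg_sq, sq_le_one_iff_abs_le_one]
    exact h1
  unfold qError
  refine (Finset.sum_le_sum fun a _ => h a).trans (le_of_eq ?_)
  simp

variable {τ : ℝ}

theorem lyapunov_init_le [Nonempty A] [Nonempty B] (hτ : 0 < τ) {R : Matrix A B ℝ}
    (hR : ∀ a b, |R a b| ≤ 1) :
    lyapunov τ R (PlayerState.init A, PlayerState.init B) ≤ 3 := by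
  have h1 := regGap_uniform_le_two hτ hR
  have h2 := qError_zero_le hR (uniform_mem_stdSimplex B)
  have h3 := qError_zero_le (abs_neg_transpose_le hR) (uniform_mem_stdSimplex A)
  have h4 := card_left_le_maxActions A B
  have h5 := card_right_le_maxActions A B
  have h6 := one_le_maxActions A B
  have h7 : (qError R (fun _ => 0) (fun _ => 1 / (Fintype.card B : ℝ)) +
      qError (-Rᵀ) (fun _ => 0) (fun _ => 1 / (Fintype.card A : ℝ))) / (2 * maxActions A B) ≤ 1 :=
    div_le_one_of_le₀ (by linarith) (by linarith)
  simp only [lyapunov, PlayerState.init]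
  linarith

theorem regGap_le_lyapunov (τ : ℝ) (R : Matrix A B ℝ) (s : PlayerState A × PlayerState B) :
    regGap τ R s.1.policy s.2.policy ≤ lyapunov τ R s := by
  have h1 := qError_nonneg R s.1.q s.2.policy
  have h2 := qError_nonneg (-Rᵀ) s.2.q s.1.policy
  have : 0 ≤ (qError R s.1.q s.2.policy + qError (-Rᵀ) s.2.q s.1.policy) /
    (2 * maxActions A B) := by positivity
  unfold lyapunov
  linarith

/-- The expected error of one player's estimates after a full round. -/
theorem sum_qError_step_le [Nonempty B] [DecidableEq A]
    (hτ : 0 < τ) {R : Matrix A B ℝ}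
    (hR : ∀ a b, |R a b| ≤ 1) {π₁ : A → ℝ} (hπ₁ : π₁ ∈ stdSimplex ℝ A) {ℓ : ℝ} (hℓ0 : 0 < ℓ)
    (hℓ : ∀ a, ℓ ≤ π₁ a) {π : A → ℝ} {π' : B → ℝ} (hπ' : π' ∈ stdSimplex ℝ B) {q : A → ℝ}
    (hq : ∀ a, |q a| ≤ 1) (q' : B → ℝ) {α c N : ℝ} (hα : 0 < α) (hc : 0 < c)
    (hN : (Fintype.card A : ℝ) ≤ N) (h1 : c * α ≤ 1)
    (hαℓ : α * ℓ ≤ 1) :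
    ∑ a, ∑ b, π₁ a * (π' b + c * α * (softmax τ q' b - π' b)) *
        qError R (fun a' => q a' + α * (if a' = a then R a b - q a else 0))
          (fun b => π' b + c * α * (softmax τ q' b - π' b)) ≤
      (1 - α * ℓ / 2) * qError R q π' + 2 * c ^ 2 * α / ℓ * N *
        (2 * (∑ b, |π' b - softmax τ ((-Rᵀ) *ᵥ π) b|) ^ 2 + 8 / τ ^ 2 * qError (-Rᵀ) q' π) +
        4 * α ^ 2 := by
  have hβ : 0 ≤ c * α := by positivity
  have a1 := sum_qError_update_le hR hπ₁
    (convexComb_mem_stdSimplex hπ' (softmax_mem_stdSimplex τ q') hβ h1) hℓ hq hα.le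
  have hη : 0 < α * ℓ / 2 := by positivity
  have a2 := qError_shift_le hR q π' (softmax τ q') (c * α) hη
  have a3 := sq_sum_abs_softmax_sub_le hτ (-Rᵀ) q' π' π
  set D := (∑ b, |softmax τ q' b - π' b|) ^ 2 with hD
  set T := 2 * (∑ b, |π' b - softmax τ ((-Rᵀ) *ᵥ π) b|) ^ 2 + 8 / τ ^ 2 * qError (-Rᵀ) q' π with hT
  set E' := qError R q (fun b => π' b + c * α * (softmax τ q' b - π' b)) with hE'
  have hE0 : 0 ≤ E' := qError_nonneg _ _ _
  have hE : 0 ≤ qError R q π' := qError_nonneg _ _ _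
  have hD0 : 0 ≤ D := sq_nonneg _
  have hx : 0 < α * ℓ := by positivity
  have hN0 : 0 ≤ N := (Nat.cast_nonneg _).trans hN
  have hG : (Fintype.card A : ℝ) * ((c * α) ^ 2 * D) ≤ N * ((c * α) ^ 2 * T) := by gcongr
  have hG0 : 0 ≤ (Fintype.card A : ℝ) * ((c * α) ^ 2 * D) := by positivity
  set G := (Fintype.card A : ℝ) * ((c * α) ^ 2 * D) with hGdef
  refine a1.trans (add_le_add_left ?_ _)
  have e : 2 * c ^ 2 * α / ℓ * N * T = 2 / (α * ℓ) * (N * ((c * α) ^ 2 * T)) := by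
    field_simp
  rw [e]
  have h3 : 2 / (α * ℓ) * G ≤ 2 / (α * ℓ) * (N * ((c * α) ^ 2 * T)) := by gcongr
  have h2 : 1 - 2 * α * ℓ ≤ 1 - α * ℓ := by linarith
  -- `(1 - x) (1 + x / 2) ≤ 1 - x / 2` and `(1 - x) (1 + 2 / x) ≤ 2 / x` for `x = α ℓ`.
  have h4 : (1 - 2 * α * ℓ) * E' ≤ (1 - α * ℓ / 2) * qError R q π' + 2 / (α * ℓ) * G := by
    have e2 : 1 / (α * ℓ / 2) = 2 / (α * ℓ) := by field_simp
    rw [e2] at a2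
    have b1 := mul_le_mul_of_nonneg_left a2 (sub_nonneg.2 hαℓ)
    have b2 : (1 - 2 * α * ℓ) * E' ≤ (1 - α * ℓ) * E' := mul_le_mul_of_nonneg_right h2 hE0
    have b3 : (1 - α * ℓ) * (1 + α * ℓ / 2) ≤ 1 - α * ℓ / 2 := by nlinarith
    have b4 : (1 - α * ℓ) * (1 + 2 / (α * ℓ)) ≤ 2 / (α * ℓ) := by
      have : α * ℓ * (2 / (α * ℓ)) = 2 := by field_simp
      nlinarith
    have b5 := mul_le_mul_of_nonneg_right b3 hE
    have b6 := mul_le_mul_of_nonneg_right b4 hG0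
    linarith
  linarith

theorem sum_lyapunov_step_eq [DecidableEq A] [DecidableEq B] (τ : ℝ) (R : Matrix A B ℝ) (α β : ℝ)
    (s : PlayerState A × PlayerState B) {p₁ : A → ℝ} {p₂ : B → ℝ}
    (e₁ : p₁ = fun a => s.1.policy a + β * (softmax τ s.1.q a - s.1.policy a))
    (e₂ : p₂ = fun b => s.2.policy b + β * (softmax τ s.2.q b - s.2.policy b))
    (h₁ : ∑ a, p₁ a = 1) (h₂ : ∑ b, p₂ b = 1) :
    ∑ a, ∑ b, p₁ a * p₂ b *
        lyapunov τ R (s.1.step τ α β a (R a b), s.2.step τ α β b ((-Rᵀ) b a)) =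
      regGap τ R p₁ p₂ +
        ((∑ a, ∑ b, p₁ a * p₂ b * qError R
          (fun a' => s.1.q a' + α * (if a' = a then R a b - s.1.q a else 0)) p₂) +
        ∑ a, ∑ b, p₂ b * p₁ a * qError (-Rᵀ)
          (fun b' => s.2.q b' + α * (if b' = b then (-Rᵀ) b a - s.2.q b else 0)) p₁) /
          (2 * maxActions A B) := by
  have hone : ∑ a, ∑ b, p₁ a * p₂ b = 1 := by
    simp_rw [← Finset.mul_sum]
    rw [h₂]
    simp_rw [mul_one]
    exact h₁
  have hone' : regGap τ R p₁ p₂ = ∑ a, ∑ b, p₁ a * p₂ b * regGap τ R p₁ p₂ := by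
    simp_rw [← Finset.sum_mul]
    rw [hone, one_mul]
  rw [hone', ← Finset.sum_add_distrib, Finset.sum_div, ← Finset.sum_add_distrib]
  refine Finset.sum_congr rfl fun a _ => ?_
  rw [← Finset.sum_add_distrib, Finset.sum_div, ← Finset.sum_add_distrib]
  refine Finset.sum_congr rfl fun b _ => ?_
  have e : lyapunov τ R (s.1.step τ α β a (R a b), s.2.step τ α β b ((-Rᵀ) b a)) =
      regGap τ R p₁ p₂ + (qError R
          (fun a' => s.1.q a' + α * (if a' = a then R a b - s.1.q a else 0)) p₂ + qError (-Rᵀ)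
          (fun b' => s.2.q b' + α * (if b' = b then (-Rᵀ) b a - s.2.q b else 0)) p₁) /
        (2 * maxActions A B) := by rw [e₁, e₂]; rfl
  rw [e]
  ring

/-- The smallness condition on the ratio `c` of the stepsizes makes the estimates track the policies
fast enough: the Lyapunov function contracts by `1 - c α / 2` in expectation, up to `5 α ^ 2`. -/
theorem sum_lyapunov_step_le [Nonempty A] [Nonempty B] [DecidableEq A] [DecidableEq B] (hτ : 0 < τ)
    (hτ' : τ ≤ 3 / 2) {R : Matrix A B ℝ} (hR : ∀ a b, |R a b| ≤ 1) {α c : ℝ} (hα0 : 0 < α)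
    (hα1 : α ≤ 1) (hc0 : 0 < c) (hc1 : c < 1)
    (hc : c ≤ ell τ (maxActions A B) ^ 3 * τ ^ 3 / (1000 * (maxActions A B : ℝ) ^ 2))
    {s : PlayerState A × PlayerState B} (hs₁ : s.1.Valid (ell τ (maxActions A B)))
    (hs₂ : s.2.Valid (ell τ (maxActions A B))) :
    ∑ a, ∑ b, (s.1.policy a + c * α * (softmax τ s.1.q a - s.1.policy a)) *
        (s.2.policy b + c * α * (softmax τ s.2.q b - s.2.policy b)) *
        lyapunov τ R (s.1.step τ α (c * α) a (R a b), s.2.step τ α (c * α) b ((-Rᵀ) b a)) ≤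
      (1 - c * α / 2) * lyapunov τ R s + 5 * α ^ 2 := by
  have hNA := card_left_le_maxActions A B
  have hNB := card_right_le_maxActions A B
  have hN1 := one_le_maxActions A B
  have hreg0 := regGap_nonneg hτ R hs₁.mem hs₂.mem
  have hdist := sq_dist_le_regGap hτ R hs₁.mem hs₂.mem
  have hv₁ := hs₁.lower
  have hv₂ := hs₂.lower
  set N : ℝ := (maxActions A B : ℝ) with hN
  have hℓ0 := ell_pos (τ := τ) hN1
  have hℓ1 := ell_le_one (τ := τ) hN1
  have hβ0 : 0 ≤ c * α := by positivity
  have hβ1 : c * α ≤ 1 := mul_le_one₀ hc1.le hα0.le hα1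
  have hL₁ : ∀ a, ell τ N ≤ s.1.policy a + c * α * (softmax τ s.1.q a - s.1.policy a) := fun a =>
    (hs₁.step hτ hNA hα0.le hα1 hβ0 hβ1 a (r := 0) (by simp)).lower a
  have hL₂ : ∀ b, ell τ N ≤ s.2.policy b + c * α * (softmax τ s.2.q b - s.2.policy b) := fun b =>
    (hs₂.step hτ hNB hα0.le hα1 hβ0 hβ1 b (r := 0) (by simp)).lower b
  have hp₁ := convexComb_mem_stdSimplex hs₁.mem (softmax_mem_stdSimplex τ s.1.q) hβ0 hβ1
  have hp₂ := convexComb_mem_stdSimplex hs₂.mem (softmax_mem_stdSimplex τ s.2.q) hβ0 hβ1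
  set ℓ := ell τ N with hℓ
  have hcN := mul_le_of_ratio_le hℓ0 hℓ1 hτ hc0 hN1 hc
  have h2β : 2 * (c * α) ≤ τ := by
    have h1 : c * α ≤ c * 1 := by gcongr
    linarith [two_mul_ratio_le hℓ0 hℓ1 hτ hτ' hc0 hN1 hcN]
  have hαℓ : α * ℓ ≤ 1 := mul_le_one₀ hα1 hℓ0.le hℓ1
  have a1 := regGap_step_le hτ hτ' hR hs₁.mem hs₂.mem s.1.q s.2.q hβ0 hβ1 h2β
  have a2 := sum_qError_step_le hτ hR hp₁ hℓ0 hL₁ (π := s.1.policy) hs₂.mem hs₁.bdd s.2.q hα0 hc0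
    hNA hβ1 hαℓ
  have a3 := sum_qError_step_le hτ (abs_neg_transpose_le hR) hp₂ hℓ0 hL₂ (π := s.2.policy) hs₁.mem
    hs₂.bdd s.1.q hα0 hc0 hNB hβ1 hαℓ
  rw [Finset.sum_comm] at a3
  have hRR : (-(-Rᵀ)ᵀ) = R := by ext; simp
  rw [hRR] at a3
  refine (sum_lyapunov_step_eq τ R α (c * α) s rfl rfl hp₁.2 hp₂.2).trans_le ?_
  set p₁ : A → ℝ := fun a => s.1.policy a + c * α * (softmax τ s.1.q a - s.1.policy a)
  set p₂ : B → ℝ := fun b => s.2.policy b + c * α * (softmax τ s.2.q b - s.2.policy b)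
  set Q₁ := ∑ a, ∑ b, p₁ a * p₂ b * qError R
          (fun a' => s.1.q a' + α * (if a' = a then R a b - s.1.q a else 0)) p₂
  set Q₂ := ∑ a, ∑ b, p₂ b * p₁ a * qError (-Rᵀ)
          (fun b' => s.2.q b' + α * (if b' = b then (-Rᵀ) b a - s.2.q b else 0)) p₁
  have hE₁ := qError_nonneg R s.1.q s.2.policy
  have hE₂ := qError_nonneg (-Rᵀ) s.2.q s.1.policy
  unfold lyapunov
  rw [← hN]
  set V := regGap τ R s.1.policy s.2.policy
  set E₁ := qError R s.1.q s.2.policy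
  set E₂ := qError (-Rᵀ) s.2.q s.1.policy
  set d₁ := (∑ a, |s.1.policy a - softmax τ (R *ᵥ s.2.policy) a|) ^ 2
  set d₂ := (∑ b, |s.2.policy b - softmax τ ((-Rᵀ) *ᵥ s.1.policy) b|) ^ 2
  have hQ : Q₁ + Q₂ ≤ (1 - α * ℓ / 2) * (E₁ + E₂) +
      2 * c ^ 2 * α / ℓ * N * (8 / τ * V + 8 / τ ^ 2 * (E₁ + E₂)) + 8 * α ^ 2 := by
    have h1 : 2 * (d₁ + d₂) ≤ 8 / τ * V := by
      rw [div_mul_eq_mul_div, le_div_iff₀ hτ]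
      linarith
    have h2 := mul_le_mul_of_nonneg_left h1
      (show 0 ≤ 2 * c ^ 2 * α / ℓ * N by positivity)
    linarith
  have hQ' : (Q₁ + Q₂) / (2 * N) ≤ ((1 - α * ℓ / 2) * (E₁ + E₂) +
      2 * c ^ 2 * α / ℓ * N * (8 / τ * V + 8 / τ ^ 2 * (E₁ + E₂)) + 8 * α ^ 2) / (2 * N) := by
    gcongr
  refine (add_le_add a1 hQ').trans ?_
  exact lyapunov_scalar_le hℓ0 hℓ1 hτ hτ' hc0 hN1 hcN hα0 hreg0 (add_nonneg hE₁ hE₂)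

end Lyapunov

/-! ### Expectations over histories -/

section Histories

variable {S : Type*} [Nonempty S]

/-- The extension of a history of length `k` to an infinite sequence, by an arbitrary constant. -/
noncomputable def extendHistory {k : ℕ} (y : Fin k → S) : ℕ → S :=
  fun j => if h : j < k then y ⟨j, h⟩ else Classical.arbitrary S

theorem extendHistory_snoc {k : ℕ} (y : Fin k → S) (a : S) :
    extendHistory (Fin.snoc y a : Fin (k + 1) → S) = Function.update (extendHistory y) k a := by
  ext j
  rcases lt_trichotomy j k with h | h | h
  · rw [Function.update_of_ne h.ne]
    simp [extendHistory, h, h.trans (Nat.lt_succ_self k), Fin.snoc]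
  · subst h
    simp [extendHistory, Fin.snoc]
  · rw [Function.update_of_ne h.ne']
    simp [extendHistory, h.not_gt, (Nat.succ_le_of_lt h).not_gt]

variable [Fintype S] {Ω : Type*} [MeasurableSpace Ω] (P : Measure Ω)
  (X : ℕ → Ω → S)

/-- The expectation of `F` at the (extended) history of the first `k` terms of the process `X`. -/
noncomputable def historyExpectation (k : ℕ) (F : (ℕ → S) → ℝ) : ℝ :=
  ∑ y : Fin k → S, P.real {ω | ∀ j < k, X j ω = extendHistory y j} * F (extendHistory y)

variable {X}

theorem integrable_and_integral_eq_historyExpectation [IsFiniteMeasure P] {k : ℕ}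
    (hX : ∀ j < k, ∀ a, MeasurableSet {ω | X j ω = a}) {F : (ℕ → S) → ℝ}
    (hF : ∀ x x' : ℕ → S, (∀ j < k, x j = x' j) → F x = F x') :
    Integrable (fun ω => F fun j => X j ω) P ∧
      ∫ ω, F (fun j => X j ω) ∂P = historyExpectation P X k F := by
  classical
  have hmeas : ∀ y : Fin k → S, MeasurableSet {ω | ∀ j < k, X j ω = extendHistory y j} := by
    intro y
    simp only [Set.ofPred_forall]
    exact MeasurableSet.iInter fun j => MeasurableSet.iInter fun hj => hX j hj _
  have hsum : (fun ω => F fun j => X j ω) = fun ω => ∑ y : Fin k → S,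
      ({ω | ∀ j < k, X j ω = extendHistory y j}).indicator (fun _ => F (extendHistory y)) ω := by
    ext ω
    rw [Finset.sum_eq_single (fun j : Fin k => X j ω)]
    · rw [Set.indicator_of_mem]
      · exact hF _ _ fun j hj => by simp [extendHistory, hj]
      · intro j hj
        simp [extendHistory, hj]
    · intro y _ hy
      refine Set.indicator_of_notMem (fun h => hy ?_) _
      ext j
      have := h j j.2
      simpa [extendHistory] using this.symm
    · simp
  have hint : ∀ y ∈ (Finset.univ : Finset (Fin k → S)), Integrable
      (({ω | ∀ j < k, X j ω = extendHistory y j}).indicator fun _ => F (extendHistory y)) P :=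
    fun y _ => (integrable_const _).indicator (hmeas y)
  rw [hsum]
  refine ⟨integrable_finsetSum _ hint, ?_⟩
  rw [integral_finsetSum _ hint]
  refine Finset.sum_congr rfl fun y _ => ?_
  rw [integral_indicator_const _ (hmeas y), smul_eq_mul]

theorem historyExpectation_const [IsProbabilityMeasure P] {k : ℕ}
    (hX : ∀ j < k, ∀ a, MeasurableSet {ω | X j ω = a}) (C : ℝ) : historyExpectation P X k
    (fun _ => C) = C := by
  rw [← (integrable_and_integral_eq_historyExpectation P hX fun _ _ _ => rfl).2]
  simp

theorem historyExpectation_mono {k : ℕ} {F G : (ℕ → S) → ℝ} (h : ∀ x, F x ≤ G x) :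
    historyExpectation P X k F ≤ historyExpectation P X k G :=
  Finset.sum_le_sum fun _ _ => mul_le_mul_of_nonneg_left (h _) measureReal_nonneg

theorem historyExpectation_mul_add_const [IsProbabilityMeasure P] {k : ℕ}
    (hX : ∀ j < k, ∀ a, MeasurableSet {ω | X j ω = a}) (F : (ℕ → S) → ℝ) (r C : ℝ) :
    historyExpectation P X k (fun x => r * F x + C) = r * historyExpectation P X k F + C := by
  nth_rewrite 2 [← historyExpectation_const P hX C]
  unfold historyExpectation
  rw [Finset.mul_sum, ← Finset.sum_add_distrib]
  exact Finset.sum_congr rfl fun y _ => by rw [mul_add, mul_left_comm]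

end Histories

section Play

variable {A₁ : Type u} {A₂ : Type v} [Fintype A₁] [Fintype A₂] [DecidableEq A₁] [DecidableEq A₂]

theorem iterates_congr (R : Matrix A₁ A₂ ℝ) (τ : ℝ) (α β : ℕ → ℝ) {x x' : ℕ → A₁ × A₂} {k : ℕ}
    (h : ∀ j < k, x j = x' j) : iterates R τ α β x k = iterates R τ α β x' k := by
  induction k with
  | zero => rfl
  | succ k ih =>
    simp only [iterates]
    rw [ih fun j hj => h j (hj.trans (Nat.lt_succ_self k)), h k (Nat.lt_succ_self k)]

variable [Nonempty A₁] [Nonempty A₂]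

theorem policy_iterates_mem (R : Matrix A₁ A₂ ℝ) (τ : ℝ) {α β : ℕ → ℝ} (h0 : ∀ k, 0 ≤ β k)
    (h1 : ∀ k, β k ≤ 1) (x : ℕ → A₁ × A₂) (k : ℕ) :
    (iterates R τ α β x k).1.policy ∈ stdSimplex ℝ A₁ ∧
      (iterates R τ α β x k).2.policy ∈ stdSimplex ℝ A₂ := by
  induction k with
  | zero => exact ⟨uniform_mem_stdSimplex A₁, uniform_mem_stdSimplex A₂⟩
  | succ k ih =>
    exact ⟨convexComb_mem_stdSimplex ih.1 (softmax_mem_stdSimplex τ _) (h0 k) (h1 k),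
      convexComb_mem_stdSimplex ih.2 (softmax_mem_stdSimplex τ _) (h0 k) (h1 k)⟩

theorem iterates_valid {R : Matrix A₁ A₂ ℝ} (hR : ∀ a b, |R a b| ≤ 1) {τ : ℝ} (hτ : 0 < τ)
    {α β : ℕ → ℝ} (hα0 : ∀ k, 0 ≤ α k) (hα1 : ∀ k, α k ≤ 1) (h0 : ∀ k, 0 ≤ β k)
    (h1 : ∀ k, β k ≤ 1) (x : ℕ → A₁ × A₂) (k : ℕ) :
    (iterates R τ α β x k).1.Valid (ell τ (maxActions A₁ A₂)) ∧
      (iterates R τ α β x k).2.Valid (ell τ (maxActions A₁ A₂)) := by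
  induction k with
  | zero =>
    exact ⟨PlayerState.valid_init hτ (card_left_le_maxActions A₁ A₂),
      PlayerState.valid_init hτ (card_right_le_maxActions A₁ A₂)⟩
  | succ k ih =>
    exact ⟨ih.1.step hτ (card_left_le_maxActions A₁ A₂) (hα0 k) (hα1 k) (h0 k) (h1 k) _ (hR _ _),
      ih.2.step hτ (card_right_le_maxActions A₁ A₂) (hα0 k) (hα1 k) (h0 k) (h1 k) _
        (abs_neg_transpose_le hR _ _)⟩

variable {Ω : Type w} [MeasurableSpace Ω] {P : Measure Ω} {R : Matrix A₁ A₂ ℝ} {τ : ℝ}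
  {α β : ℕ → ℝ} {K : ℕ} {X : ℕ → Ω → A₁ × A₂}

/-- The tower property: the expectation of a function of the iterates after round `k`, conditioned
on the history before round `k`. -/
theorem IsPlay.historyExpectation_succ (hX : IsPlay P R τ α β K X) {k : ℕ} (hk : k < K)
    (G : PlayerState A₁ × PlayerState A₂ → ℝ) :
    historyExpectation P X (k + 1) (fun x => G (iterates R τ α β x (k + 1))) =
      historyExpectation P X k (fun x => ∑ a, ∑ b,
        ((iterates R τ α β x k).1.policy a + β k *
          (softmax τ (iterates R τ α β x k).1.q a - (iterates R τ α β x k).1.policy a)) *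
        ((iterates R τ α β x k).2.policy b + β k *
          (softmax τ (iterates R τ α β x k).2.q b - (iterates R τ α β x k).2.policy b)) *
        G ((iterates R τ α β x k).1.step τ (α k) (β k) a (R a b),
          (iterates R τ α β x k).2.step τ (α k) (β k) b ((-Rᵀ) b a))) := by
  unfold historyExpectation
  rw [← (Fin.snocEquiv fun _ : Fin (k + 1) => A₁ × A₂).sum_comp, Fintype.sum_prod_type_right]
  refine Finset.sum_congr rfl fun y _ => ?_
  rw [Fintype.sum_prod_type, Finset.mul_sum]
  refine Finset.sum_congr rfl fun a _ => ?_
  rw [Finset.mul_sum]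
  refine Finset.sum_congr rfl fun b _ => ?_
  have e1 : (Fin.snocEquiv fun _ : Fin (k + 1) => A₁ × A₂) ((a, b), y) =
      (Fin.snoc y (a, b) : Fin (k + 1) → A₁ × A₂) := rfl
  rw [e1, extendHistory_snoc]
  set x := Function.update (extendHistory y) k (a, b) with hx
  have hxk : x k = (a, b) := Function.update_self _ _ _
  have hxj : ∀ j < k, x j = extendHistory y j := fun j hj => Function.update_of_ne hj.ne _ _
  have h1 := hX.sampling k hk x
  have e2 : {ω | ∀ j < k + 1, X j ω = x j} = {ω | ∀ j ≤ k, X j ω = x j} := by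
    simp only [Nat.lt_succ_iff]
  have e3 : {ω | ∀ j < k, X j ω = x j} = {ω | ∀ j < k, X j ω = extendHistory y j} := by
    ext ω
    exact forall₂_congr fun j hj => by rw [hxj j hj]
  rw [e2, h1, e3]
  simp only [iterates, hxk, PlayerState.step]
  rw [iterates_congr R τ α β hxj]
  ring

/-- The expected Lyapunov function satisfies a scalar recursion. -/
theorem IsPlay.historyExpectation_lyapunov_succ_le [IsProbabilityMeasure P]
    (hX : IsPlay P R τ α β K X) (hτ : 0 < τ) (hτ' : τ ≤ 3 / 2) (hR : ∀ a b, |R a b| ≤ 1)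
    {c : ℝ} (hc0 : 0 < c) (hc1 : c < 1)
    (hc : c ≤ ell τ (maxActions A₁ A₂) ^ 3 * τ ^ 3 / (1000 * (maxActions A₁ A₂ : ℝ) ^ 2))
    (hα0 : ∀ k, 0 < α k) (hα1 : ∀ k, α k ≤ 1) (hβ : ∀ k, β k = c * α k) {k : ℕ} (hk : k < K) :
    historyExpectation P X (k + 1) (fun x => lyapunov τ R (iterates R τ α β x (k + 1))) ≤
      (1 - c * α k / 2) * historyExpectation P X k (fun x => lyapunov τ R (iterates R τ α β x k)) +
        5 * α k ^ 2 := by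
  have hβ0 : ∀ k, 0 ≤ β k := fun k => by rw [hβ]; exact mul_nonneg hc0.le (hα0 k).le
  have hβ1 : ∀ k, β k ≤ 1 := fun k => by
    rw [hβ]; exact mul_le_one₀ hc1.le (hα0 k).le (hα1 k)
  rw [hX.historyExpectation_succ hk]
  have h1 : ∀ x : ℕ → A₁ × A₂, _ := fun x =>
    sum_lyapunov_step_le hτ hτ' hR (hα0 k) (hα1 k) hc0 hc1 hc
      (iterates_valid hR hτ (fun k => (hα0 k).le) hα1 hβ0 hβ1 x k).1
      (iterates_valid hR hτ (fun k => (hα0 k).le) hα1 hβ0 hβ1 x k).2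
  rw [← hβ k] at h1
  refine (historyExpectation_mono P h1).trans_eq ?_
  rw [historyExpectation_mul_add_const P fun j hj => hX.measurable j (hj.trans hk), hβ k]

theorem IsPlay.outputGap_integrable [IsProbabilityMeasure P] (hX : IsPlay P R τ α β K X) :
    Integrable (outputGap R τ α β K X) P ∧
      ∫ ω, outputGap R τ α β K X ω ∂P = historyExpectation P X K fun x =>
        nashGap R (iterates R τ α β x K).1.policy (iterates R τ α β x K).2.policy :=
  integrable_and_integral_eq_historyExpectation P hX.measurable
    (F := fun x => nashGap R (iterates R τ α β x K).1.policy (iterates R τ α β x K).2.policy)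
    fun x x' h => by rw [iterates_congr R τ α β h]

theorem IsPlay.integral_outputGap_le_of_forall [IsProbabilityMeasure P]
    (hX : IsPlay P R τ α β K X) {C : ℝ} (h : ∀ x : ℕ → A₁ × A₂,
      nashGap R (iterates R τ α β x K).1.policy (iterates R τ α β x K).2.policy ≤ C) :
    ∫ ω, outputGap R τ α β K X ω ∂P ≤ C := by
  rw [hX.outputGap_integrable.2]
  exact (historyExpectation_mono P h).trans_eq (historyExpectation_const P hX.measurable C)

/-- The comparison principle: every supersolution `b` of the scalar recursion with `3 ≤ b 0` bounds
the expected output gap up to the bias of the regularization. -/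
theorem IsPlay.integral_outputGap_le [IsProbabilityMeasure P]
    (hX : IsPlay P R τ α β K X) (hτ : 0 < τ) (hR : ∀ a b, |R a b| ≤ 1)
    {c : ℝ} (hc0 : 0 < c) (hc1 : c < 1)
    (hc : c ≤ ell τ (maxActions A₁ A₂) ^ 3 * τ ^ 3 / (1000 * (maxActions A₁ A₂ : ℝ) ^ 2))
    (hα0 : ∀ k, 0 < α k) (hα1 : ∀ k, α k ≤ 1) (hβ : ∀ k, β k = c * α k) {b : ℕ → ℝ}
    (hb0 : 3 ≤ b 0) (hb : ∀ k, (1 - c * α k / 2) * b k + 5 * α k ^ 2 ≤ b (k + 1)) :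
    ∫ ω, outputGap R τ α β K X ω ∂P ≤ b K + 2 * τ * Real.log (maxActions A₁ A₂) := by
  have hβ0 : ∀ k, 0 ≤ β k := fun k => by rw [hβ]; exact mul_nonneg hc0.le (hα0 k).le
  have hβ1 : ∀ k, β k ≤ 1 := fun k => by
    rw [hβ]; exact mul_le_one₀ hc1.le (hα0 k).le (hα1 k)
  have hcontr : ∀ k, 0 ≤ 1 - c * α k / 2 := fun k => by
    have := hβ1 k
    rw [hβ] at this
    linarith
  rcases le_or_gt τ (3 / 2) with hτ' | hτ'
  · have hE : ∀ k ≤ K,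
        historyExpectation P X k (fun x => lyapunov τ R (iterates R τ α β x k)) ≤ b k := by
      intro k
      induction k with
      | zero =>
        intro _
        refine le_trans (le_of_eq ?_) ((lyapunov_init_le hτ hR).trans hb0)
        exact historyExpectation_const P (X := X) (k := 0) (by simp) _
      | succ k ih =>
        intro hk
        have h1 := hX.historyExpectation_lyapunov_succ_le hτ hτ' hR hc0 hc1 hc hα0 hα1 hβ
          (Nat.lt_of_succ_le hk)
        have h2 := mul_le_mul_of_nonneg_left (ih (Nat.le_of_succ_le hk)) (hcontr k)
        linarith [hb k]
    rw [hX.outputGap_integrable.2]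
    set C := 2 * τ * Real.log (maxActions A₁ A₂) with hC
    have h1 : ∀ x : ℕ → A₁ × A₂,
        nashGap R (iterates R τ α β x K).1.policy (iterates R τ α β x K).2.policy ≤
          lyapunov τ R (iterates R τ α β x K) + C := fun x => by
      have hm := policy_iterates_mem R τ (α := α) hβ0 hβ1 x K
      exact (nashGap_le_regGap_add hτ hm.1 hm.2).trans
        (add_le_add_left (regGap_le_lyapunov τ R _) C)
    refine (historyExpectation_mono P h1).trans ?_
    have h2 := historyExpectation_mul_add_const P hX.measurable
      (fun x => lyapunov τ R (iterates R τ α β x K)) 1 C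
    simp only [one_mul] at h2
    rw [h2]
    linarith [hE K le_rfl]
  · -- For large `τ` the bias exceeds the range of the Nash gap, unless the game is trivial.
    have hbK : ∀ k, 0 ≤ b k := by
      intro k
      induction k with
      | zero => linarith
      | succ k ih => nlinarith [hb k, mul_nonneg (hcontr k) ih, sq_nonneg (α k)]
    refine hX.integral_outputGap_le_of_forall fun x => ?_
    have hm := policy_iterates_mem R τ (α := α) hβ0 hβ1 x K
    have hK := hbK K
    rcases Nat.lt_or_ge 1 (maxActions A₁ A₂) with hN | hN
    · have h1 := nashGap_le_two hR hm.1 hm.2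
      have h2 : Real.log 2 ≤ Real.log (maxActions A₁ A₂) :=
        Real.log_le_log (by norm_num) (by exact_mod_cast hN)
      have h3 := Real.log_two_gt_d9
      nlinarith
    · have : Subsingleton A₁ := Fintype.card_le_one_iff_subsingleton.1 ((le_max_left _ _).trans hN)
      have : Subsingleton A₂ := Fintype.card_le_one_iff_subsingleton.1 ((le_max_right _ _).trans hN)
      have h1 := nashGap_nonpos_of_subsingleton (R := R) hm.1 hm.2
      have h2 : 0 ≤ Real.log (maxActions A₁ A₂) := Real.log_natCast_nonneg _
      have h3 : 0 ≤ 2 * τ * Real.log (maxActions A₁ A₂) := by positivity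
      linarith

end Play

/-! ### Supersolutions of the scalar recursion -/

theorem one_sub_div_le_rpow {a x : ℝ} (ha : 0 ≤ a) (hx : 0 < x) :
    1 - a / x ≤ (x / (x + 1)) ^ a := by
  have hpos : 0 < x / (x + 1) := by positivity
  rw [Real.rpow_def_of_pos hpos]
  have h1 := Real.one_sub_inv_le_log_of_pos hpos
  have h2 : 1 - (x / (x + 1))⁻¹ = -(1 / x) := by field_simp; ring
  rw [h2] at h1
  have h3 := Real.add_one_le_exp (Real.log (x / (x + 1)) * a)
  have h4 := mul_le_mul_of_nonneg_right h1 ha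
  have h5 : -(1 / x) * a = -(a / x) := by ring
  linarith

theorem constant_supersolution {c α M : ℝ} (hc : 0 < c) (hM : 1 ≤ M) (k : ℕ) :
    (1 - c * α / 2) * (3 * (1 - c * α / 2) ^ k + 10 * M / c * α) + 5 * α ^ 2 ≤
      3 * (1 - c * α / 2) ^ (k + 1) + 10 * M / c * α := by
  have h : c * α / 2 * (10 * M / c * α) = 5 * M * α ^ 2 := by field_simp; ring
  have h2 : 5 * α ^ 2 ≤ 5 * M * α ^ 2 := by nlinarith [sq_nonneg α]
  rw [pow_succ (1 - c * α / 2)]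
  linarith

theorem harmonic_supersolution {c α h M : ℝ} (hc : 0 < c) (hα : 2 / c < α) (hh : 0 < h)
    (hM : 1 ≤ M) {x : ℝ} (hx : 0 < x) :
    (1 - c * (α / x) / 2) * (3 * (h / x) ^ (c * α / 2) + 10 * M * α / (c * α - 2) * (α / x)) +
        5 * (α / x) ^ 2 ≤
      3 * (h / (x + 1)) ^ (c * α / 2) + 10 * M * α / (c * α - 2) * (α / (x + 1)) := by
  have hcα : 0 < c * α - 2 := by
    rw [div_lt_iff₀ hc] at hα; linarith
  have hα0 : 0 < α := lt_trans (by positivity) hα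
  have h1 := one_sub_div_le_rpow (show 0 ≤ c * α / 2 by positivity) hx
  have h2 : (h / (x + 1)) ^ (c * α / 2) = (x / (x + 1)) ^ (c * α / 2) * (h / x) ^ (c * α / 2) := by
    rw [← Real.mul_rpow (by positivity) (by positivity)]
    congr 1
    field_simp
  have h3 := mul_le_mul_of_nonneg_right h1 (show 0 ≤ (h / x) ^ (c * α / 2) by positivity)
  have h4 : c * (α / x) / 2 = c * α / 2 / x := by ring
  have h5 : 10 * M * α / (c * α - 2) * (α / (x + 1)) -
      (1 - c * α / 2 / x) * (10 * M * α / (c * α - 2) * (α / x)) - 5 * (α / x) ^ 2 =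
      5 * α ^ 2 / x ^ 2 * (M - 1) + 10 * M * α ^ 2 / (c * α - 2) / (x ^ 2 * (x + 1)) := by
    obtain ⟨D, hD⟩ : ∃ D, D = c * α - 2 := ⟨_, rfl⟩
    rw [← hD] at hcα ⊢
    rw [show c * α = D + 2 by linarith]
    field_simp
    ring
  have h6 : 0 ≤ 5 * α ^ 2 / x ^ 2 * (M - 1) + 10 * M * α ^ 2 / (c * α - 2) / (x ^ 2 * (x + 1)) := by
    have : 0 ≤ M - 1 := by linarith
    positivity
  rw [h2, h4]
  linarith

theorem polynomial_supersolution {c α h z M : ℝ} (hc : 0 < c) (hα : 0 < α) (hz0 : 0 < z)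
    (hz1 : z < 1) (hh : (4 * z / (c * α)) ^ (1 / (1 - z)) ≤ h) (hM : 1 ≤ M) {x : ℝ} (hx : h ≤ x) :
    (1 - c * (α / x ^ z) / 2) *
        (3 * Real.exp (-(c * α * (x ^ (1 - z) - h ^ (1 - z)) / (2 * (1 - z)))) +
          20 * M / c * (α / x ^ z)) + 5 * (α / x ^ z) ^ 2 ≤
      3 * Real.exp (-(c * α * ((x + 1) ^ (1 - z) - h ^ (1 - z)) / (2 * (1 - z)))) +
        20 * M / c * (α / (x + 1) ^ z) := by
  have hz : 0 < 1 - z := by linarith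
  have hh0 : 0 < h := lt_of_lt_of_le (by positivity) hh
  have hx0 : 0 < x := hh0.trans_le hx
  have hxz : x ^ (1 - z) = x / x ^ z := by rw [Real.rpow_sub hx0, Real.rpow_one]
  have hu0 : 0 < x ^ z := by positivity
  -- The exponential term: Bernoulli's inequality bounds the increment of `x ^ (1 - z)`.
  have h1 : (x + 1) ^ (1 - z) ≤ x ^ (1 - z) + (1 - z) / x ^ z := by
    have hb := rpow_one_add_le_one_add_mul_self (s := 1 / x) (p := 1 - z)
      (by have : 0 < 1 / x := by positivity
          linarith) hz.le (by linarith)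
    have e : (x + 1) ^ (1 - z) = x ^ (1 - z) * (1 + 1 / x) ^ (1 - z) := by
      rw [← Real.mul_rpow hx0.le (by positivity)]
      congr 1
      field_simp
    rw [e]
    refine (mul_le_mul_of_nonneg_left hb (by positivity)).trans (le_of_eq ?_)
    rw [hxz]
    field_simp
  have h2 : (1 - c * (α / x ^ z) / 2) *
        Real.exp (-(c * α * (x ^ (1 - z) - h ^ (1 - z)) / (2 * (1 - z)))) ≤
      Real.exp (-(c * α * ((x + 1) ^ (1 - z) - h ^ (1 - z)) / (2 * (1 - z)))) := by
    have hexp := Real.add_one_le_exp (-(c * (α / x ^ z) / 2))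
    refine (mul_le_mul_of_nonneg_right (by linarith :
      1 - c * (α / x ^ z) / 2 ≤ Real.exp (-(c * (α / x ^ z) / 2))) (Real.exp_pos _).le).trans ?_
    rw [← Real.exp_add]
    refine Real.exp_le_exp.2 ?_
    have hi : c * α * ((x + 1) ^ (1 - z) - h ^ (1 - z)) / (2 * (1 - z)) ≤
        c * α * (x ^ (1 - z) + (1 - z) / x ^ z - h ^ (1 - z)) / (2 * (1 - z)) := by gcongr
    have he : c * α * (x ^ (1 - z) + (1 - z) / x ^ z - h ^ (1 - z)) / (2 * (1 - z)) =
        c * α * (x ^ (1 - z) - h ^ (1 - z)) / (2 * (1 - z)) + c * (α / x ^ z) / 2 := by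
      field_simp; ring
    linarith
  -- The noise term: the stepsize decays slowly enough, by the lower bound on `h`.
  have h3 : 4 * z / (c * α) ≤ x / x ^ z := by
    rw [← hxz]
    have e : 4 * z / (c * α) = ((4 * z / (c * α)) ^ (1 / (1 - z))) ^ (1 - z) := by
      rw [← Real.rpow_mul (by positivity), one_div_mul_cancel hz.ne', Real.rpow_one]
    rw [e]
    exact Real.rpow_le_rpow (by positivity) (hh.trans hx) hz.le
  have h4 : z / x ≤ c * α / 4 / x ^ z := by
    rw [div_le_div_iff₀ (by positivity) hu0] at h3
    rw [div_le_div_iff₀ hx0 hu0]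
    linarith
  have h5 : (1 - z / x) / x ^ z ≤ 1 / (x + 1) ^ z := by
    have h := one_sub_div_le_rpow hz0.le hx0
    rw [Real.div_rpow hx0.le (by positivity)] at h
    rw [div_le_div_iff₀ hu0 (by positivity)]
    rwa [le_div_iff₀ (by positivity), ← one_mul (x ^ z)] at h
  have h6 : (1 - c * (α / x ^ z) / 2) * (20 * M / c * (α / x ^ z)) + 5 * (α / x ^ z) ^ 2 ≤
      20 * M / c * (α / (x + 1) ^ z) := by
    have e1 : 20 * M / c * (α / (x + 1) ^ z) = 20 * M * α / c * (1 / (x + 1) ^ z) := by ring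
    rw [e1]
    have h7 : (1 - c * α / 4 / x ^ z) / x ^ z ≤ 1 / (x + 1) ^ z := by
      refine le_trans ?_ h5
      gcongr
    have h8 := mul_le_mul_of_nonneg_left h7 (show 0 ≤ 20 * M * α / c by positivity)
    refine le_trans ?_ h8
    have e2 : 20 * M * α / c * ((1 - c * α / 4 / x ^ z) / x ^ z) -
        ((1 - c * (α / x ^ z) / 2) * (20 * M / c * (α / x ^ z)) + 5 * (α / x ^ z) ^ 2) =
        5 * (M - 1) * (α / x ^ z) ^ 2 := by
      field_simp
      ring
    have : 0 ≤ M - 1 := by linarith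
    have : 0 ≤ 5 * (M - 1) * (α / x ^ z) ^ 2 := by positivity
    linarith
  linarith

end DSBR
theorem theorem1 :
    ∃ c₀ c₁ c₂ c₃ : ℝ, 0 < c₀ ∧ 0 < c₁ ∧ 0 < c₂ ∧ 0 < c₃ ∧
      ∀ (A₁ : Type u) (A₂ : Type v) [Fintype A₁] [Fintype A₂] [DecidableEq A₁] [DecidableEq A₂]
        [Nonempty A₁] [Nonempty A₂] (R : Matrix A₁ A₂ ℝ) (_ : ∀ a₁ a₂, |R a₁ a₂| ≤ 1)
        (Amax : ℝ) (_ : Amax = DSBR.maxActions A₁ A₂)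
        (τ : ℝ) (_ : 0 < τ) (c : ℝ) (_ : 0 < c) (_ : c < 1)
        (_ : c ≤ DSBR.ell τ Amax ^ 3 * τ ^ 3 / (c₀ * Amax ^ 2))
        (Ω : Type w) [MeasurableSpace Ω] (P : MeasureTheory.Measure Ω)
        [MeasureTheory.IsProbabilityMeasure P]
        (K : ℕ) (X : ℕ → Ω → A₁ × A₂) (αs βs : ℕ → ℝ) (_ : ∀ k, βs k = c * αs k)
        (_ : DSBR.IsPlay P R τ αs βs K X),
        -- constant stepsizes
        (∀ α : ℝ, 0 < α → c * α ≤ 1 → (∀ k, αs k = α) →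
          MeasureTheory.Integrable (DSBR.outputGap R τ αs βs K X) P ∧
          ∫ ω, DSBR.outputGap R τ αs βs K X ω ∂P ≤
            3 * (1 - c * α / 2) ^ K + c₁ * Amax ^ (3 / 2 : ℝ) / c * α
              + 2 * τ * Real.log Amax) ∧
        -- stepsizes of order `1 / k`
        (∀ α h : ℝ, 2 / c < α → α < h → (∀ k : ℕ, αs k = α / (k + h)) →
          MeasureTheory.Integrable (DSBR.outputGap R τ αs βs K X) P ∧
          ∫ ω, DSBR.outputGap R τ αs βs K X ω ∂P ≤
            3 * (h / (K + h)) ^ (c * α / 2)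
              + c₂ * Amax ^ (3 / 2 : ℝ) * α / (c * α - 2) * (α / (K + h))
              + 2 * τ * Real.log Amax) ∧
        -- stepsizes of order `1 / k ^ z`
        (∀ α h z : ℝ, 0 < α → 0 < z → z < 1 → (4 * z / (c * α)) ^ (1 / (1 - z)) ≤ h →
          α ≤ h ^ z → (∀ k : ℕ, αs k = α / (k + h) ^ z) →
          MeasureTheory.Integrable (DSBR.outputGap R τ αs βs K X) P ∧
          ∫ ω, DSBR.outputGap R τ αs βs K X ω ∂P ≤
            3 * Real.exp (-(c * α * ((K + h) ^ (1 - z) - h ^ (1 - z)) / (2 * (1 - z))))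
              + c₃ * Amax ^ (3 / 2 : ℝ) / c * (α / (K + h) ^ z)
              + 2 * τ * Real.log Amax) := by
  refine ⟨1000, 10, 10, 20, by norm_num, by norm_num, by norm_num, by norm_num, ?_⟩
  intro A₁ A₂ _ _ _ _ _ _ R hR Amax hAmax τ hτ c hc0 hc1 hc Ω _ P _ K X αs βs hβ hX
  subst hAmax
  have hM : (1 : ℝ) ≤ (DSBR.maxActions A₁ A₂ : ℝ) ^ (3 / 2 : ℝ) :=
    Real.one_le_rpow (DSBR.one_le_maxActions A₁ A₂) (by norm_num)
  set M := (DSBR.maxActions A₁ A₂ : ℝ) ^ (3 / 2 : ℝ)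
  refine ⟨fun α hα0 hcα hα => ?_, fun α h hα0 hh hα => ?_, fun α h z hα0 hz0 hz1 hh hαh hα => ?_⟩
  · refine ⟨hX.outputGap_integrable.1, ?_⟩
    rcases le_or_gt α 1 with hα1 | hα1
    · refine hX.integral_outputGap_le hτ hR hc0 hc1 hc (fun k => by rw [hα]; exact hα0)
        (fun k => by rw [hα]; exact hα1) hβ
        (b := fun k => 3 * (1 - c * α / 2) ^ k + 10 * M / c * α) ?_ fun k => ?_
      · have : 0 ≤ 10 * M / c * α := by positivity
        simpa using this
      · rw [hα]
        exact DSBR.constant_supersolution hc0 hM k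
    · -- For `1 < α` the estimates may be unbounded, but the bound exceeds the range of the gap.
      refine hX.integral_outputGap_le_of_forall fun x => ?_
      have hm := DSBR.policy_iterates_mem R τ (α := αs) (β := βs)
        (fun k => by rw [hβ, hα]; positivity) (fun k => by rw [hβ, hα]; exact hcα) x K
      refine (DSBR.nashGap_le_two hR hm.1 hm.2).trans ?_
      have h1 : 0 ≤ 3 * (1 - c * α / 2) ^ K :=
        mul_nonneg (by norm_num) (pow_nonneg (by linarith) K)
      have h2 : 10 ≤ 10 * M / c := by
        rw [le_div_iff₀ hc0]; linarith
      have h3 : 0 ≤ 2 * τ * Real.log (DSBR.maxActions A₁ A₂) :=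
        mul_nonneg (by positivity) (Real.log_natCast_nonneg _)
      nlinarith
  · refine ⟨hX.outputGap_integrable.1, ?_⟩
    have hα1 : 0 < α := lt_trans (by positivity) hα0
    have hh0 : 0 < h := hα1.trans hh
    have hcα : 0 < c * α - 2 := by
      have := hα0
      rw [div_lt_iff₀ hc0] at this
      linarith
    refine hX.integral_outputGap_le hτ hR hc0 hc1 hc (fun k => by rw [hα]; positivity)
      (fun k => ?_) hβ
      (b := fun k => 3 * (h / (k + h)) ^ (c * α / 2) + 10 * M * α / (c * α - 2) * (α / (k + h)))
      ?_ fun k => ?_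
    · rw [hα, div_le_one (by positivity)]
      have : (0 : ℝ) ≤ k := Nat.cast_nonneg k
      linarith
    · have : 0 ≤ 10 * M * α / (c * α - 2) * (α / h) := by positivity
      simpa [hh0.ne'] using this
    · have hs := DSBR.harmonic_supersolution hc0 hα0 hh0 hM (x := k + h) (by positivity)
      rw [hα]
      have e : ((k + 1 : ℕ) : ℝ) + h = k + h + 1 := by push_cast; ring
      simpa only [e] using hs
  · refine ⟨hX.outputGap_integrable.1, ?_⟩
    have hh0 : 0 < h := lt_of_lt_of_le (by positivity) hh
    have hx : ∀ k : ℕ, h ≤ k + h := fun k => by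
      have : (0 : ℝ) ≤ k := Nat.cast_nonneg k
      linarith
    refine hX.integral_outputGap_le hτ hR hc0 hc1 hc (fun k => by rw [hα]; positivity)
      (fun k => ?_) hβ
      (b := fun k => 3 * Real.exp (-(c * α * ((k + h) ^ (1 - z) - h ^ (1 - z)) / (2 * (1 - z))))
        + 20 * M / c * (α / (k + h) ^ z)) ?_ fun k => ?_
    · rw [hα, div_le_one (by positivity)]
      exact hαh.trans (Real.rpow_le_rpow hh0.le (hx k) hz0.le)
    · have : 0 ≤ 20 * M / c * (α / h ^ z) := by positivity
      simpa using this
    · have hs := DSBR.polynomial_supersolution hc0 hα0 hz0 hz1 hh hM (hx k)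
      rw [hα]
      have e : ((k + 1 : ℕ) : ℝ) + h = k + h + 1 := by push_cast; ring
      simpa only [e] using hs
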